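/- For $\theta>0$ let $D_\theta$ be a random variable with the (generalized) Dickman distribution with parameter $\theta$, i.e. the unique law of a non-negative random variable $W$ such that $W=_d U^{1/\theta}(W+1)$, where $U$ is uniform on $[0,1]$ and independent of $W$. For non-negative random variables $X,Y$ let $$d_K(X,Y)=\sup_{a\ge 0}\bigl|\mathbf{P}(X\le a)-\mathbf{P}(Y\le a)\bigr|$$ be the Kolmogorov distance between their laws. Let $\theta>0$ and $\beta\in\mathbb{R}$. For integers $n\ge l\ge 1$ with $l\ge\theta-\beta$, let $W_n=n^{-1}\sum_{k=l}^n kB_k$, where $B_l,\dots,B_n$ are independent and $B_k\sim\mathrm{Ber}(\theta/(k+\beta))$, i.e. $\mathbf{P}(B_k=1)=\theta/(k+\beta)=1-\mathbf{P}(B_k=0)$. Then there exists a constant $C\in(0,\infty)$ depending only on $\theta$ and $\beta$ such that, for all such $l$ and $n$, $$d_K(W_n,D_\theta)\le\begin{cases} C\,\dfrac{l+|\beta|\log(n/l)}{n}, & \theta\ge 1,\\[2mm] \dfrac{C\,l^\theta}{n^\theta}, & \theta\in(0,1).\end{cases}$$ Moreover, the bound is of optimal order in $n$: for every integer $l\ge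 1$ with $l\ge\theta-\beta$ there exists a constant $C'\in(0,\infty)$ depending only on $\theta$, $\beta$ and $l$ such that, for all integers $n\ge l$, $$d_K(W_n,D_\theta)\ge\begin{cases} C'\,\dfrac{1+|\beta|\log n}{n}, & \theta\ge 1,\\[2mm] \dfrac{C'}{n^\theta}, & \theta\in(0,1).\end{cases}$$ -/

import Mathlib

open MeasureTheory ProbabilityTheory

universe u

/-- The uniform distribution on `[0, 1]`. -/
noncomputable def uniform01 : Measure ℝ := volume.restrict (Set.Icc 0 1)

instance : IsProbabilityMeasure uniform01 := ⟨by simp [uniform01]⟩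

/-- The distributional transformation `W ↦ W* = U ^ (1 / θ) * (W + 1)` on laws: if `W` has law `μ`
and `U` is uniform on `[0, 1]` and independent of `W`, this is the law of `W*`. -/
noncomputable def dickmanTransform (θ : ℝ) (μ : Measure ℝ) : Measure ℝ :=
  (uniform01.prod μ).map (fun p => p.1 ^ (1 / θ) * (p.2 + 1))

/-- `μ` is the law of a non-negative fixed point (in distribution) of `W ↦ U ^ (1 / θ) * (W + 1)`. -/
structure IsDickman (θ : ℝ) (μ : Measure ℝ) : Prop where
  isProbabilityMeasure : IsProbabilityMeasure μ
  nonneg : μ (Set.Iio 0) = 0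
  fixed : dickmanTransform θ μ = μ

namespace DickmanAux

lemma measurable_step (θ : ℝ) : Measurable (fun p : ℝ × ℝ => p.1 ^ (1 / θ) * (p.2 + 1)) := by
  fun_prop

/-! ### Uniqueness, through characteristic functions -/

lemma charFun_fixed {θ : ℝ} {μ : Measure ℝ} (h : IsDickman θ μ) (t : ℝ) :
    charFun μ t = ∫ x, Complex.exp ((t * x ^ (1 / θ) : ℝ) * Complex.I)
      * charFun μ (t * x ^ (1 / θ)) ∂uniform01 := by
  have := h.isProbabilityMeasure
  conv_lhs => rw [← h.fixed]
  rw [dickmanTransform, charFun_apply_real, integral_map (measurable_step θ).aemeasurable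
    (by fun_prop), integral_prod]
  · congr 1
    ext x
    rw [charFun_apply_real, ← integral_const_mul]
    congr 1
    ext y
    rw [← Complex.exp_add]
    congr 1
    push_cast
    ring
  · refine Integrable.of_bound (C := 1) (by fun_prop) ?_
    refine Filter.Eventually.of_forall fun p => ?_
    rw [← Complex.ofReal_mul, Complex.norm_exp_ofReal_mul_I]

lemma unique {θ : ℝ} (hθ : 0 < θ) {μ ν : Measure ℝ} (hμ : IsDickman θ μ) (hν : IsDickman θ ν) :
    μ = ν := by
  have := hμ.isProbabilityMeasure
  have := hν.isProbabilityMeasure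
  have hpow : Continuous (fun x : ℝ => x ^ (1 / θ)) :=
    Real.continuous_rpow_const (by positivity)
  set h : ℝ → ℝ := fun t => ‖charFun μ t - charFun ν t‖ with hh
  have hc : Continuous h := by
    have h1 : Continuous (charFun μ) := continuous_charFun
    have h2 : Continuous (charFun ν) := continuous_charFun
    fun_prop
  have h0 : h 0 = 0 := by simp [hh]
  have hmu : Continuous (charFun μ) := continuous_charFun
  have hnu : Continuous (charFun ν) := continuous_charFun
  have hle : ∀ t, h t ≤ ∫ x in (0 : ℝ)..1, h (t * x ^ (1 / θ)) := by
    intro t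
    have e : charFun μ t - charFun ν t = ∫ x, Complex.exp ((t * x ^ (1 / θ) : ℝ) * Complex.I)
        * (charFun μ (t * x ^ (1 / θ)) - charFun ν (t * x ^ (1 / θ))) ∂uniform01 := by
      rw [charFun_fixed hμ, charFun_fixed hν, ← integral_sub]
      · simp only [mul_sub]
      · exact Continuous.integrableOn_Icc (by fun_prop)
      · exact Continuous.integrableOn_Icc (by fun_prop)
    rw [intervalIntegral.integral_of_le zero_le_one, ← integral_Icc_eq_integral_Ioc]
    have e2 := norm_integral_le_integral_norm (μ := uniform01) (fun x : ℝ =>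
      Complex.exp ((t * x ^ (1 / θ) : ℝ) * Complex.I)
        * (charFun μ (t * x ^ (1 / θ)) - charFun ν (t * x ^ (1 / θ))))
    rw [← e] at e2
    simp only [norm_mul, Complex.norm_exp_ofReal_mul_I, one_mul] at e2
    exact e2
  have hz : ∀ T, h T = 0 := by
    intro T
    obtain ⟨s, hs, hmax⟩ := (isCompact_Icc (a := -|T|) (b := |T|)).exists_isMaxOn
      ⟨0, by simp⟩ hc.continuousOn
    have hm : h s = 0 := by
      by_contra hne
      have hpos : 0 < h s := lt_of_le_of_ne (norm_nonneg _) (Ne.symm hne)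
      have key : 0 < ∫ x in (0 : ℝ)..1, (h s - h (s * x ^ (1 / θ))) := by
        refine intervalIntegral.integral_pos zero_lt_one (by fun_prop) ?_ ⟨0, by simp, ?_⟩
        · intro x hx
          have hx1 : x ^ (1 / θ) ≤ 1 := Real.rpow_le_one hx.1.le hx.2 (by positivity)
          have hx0 : 0 ≤ x ^ (1 / θ) := Real.rpow_nonneg hx.1.le _
          have hmem : s * x ^ (1 / θ) ∈ Set.Icc (-|T|) |T| := by
            rw [Set.mem_Icc, ← abs_le] at hs ⊢
            rw [abs_mul, abs_of_nonneg hx0]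
            exact (mul_le_of_le_one_right (abs_nonneg _) hx1).trans hs
          exact sub_nonneg.2 (hmax hmem)
        · rw [Real.zero_rpow (by positivity), mul_zero, h0, sub_zero]
          exact hpos
      rw [intervalIntegral.integral_sub (by simp)
        (Continuous.intervalIntegrable (by fun_prop) _ _)] at key
      simp only [intervalIntegral.integral_const, sub_zero, one_smul] at key
      linarith [hle s]
    have hT : h T ≤ h s := hmax (by simp [← abs_le])
    exact le_antisymm (hT.trans hm.le) (norm_nonneg _)
  refine Measure.ext_of_charFun ?_
  ext t
  exact sub_eq_zero.1 (norm_eq_zero.1 (hz t))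

/-! ### Existence, through the perpetuity `∑ⱼ (U₀ ⋯ Uⱼ) ^ (1 / θ)` -/

/-- Put `x` in front of the sequence `y`. -/
def cons (p : ℝ × (ℕ → ℝ)) : ℕ → ℝ := fun i => Nat.casesOn i p.1 p.2

lemma measurable_cons : Measurable cons := by
  refine measurable_pi_lambda _ fun i => ?_
  cases i with
  | zero => exact measurable_fst
  | succ i => exact (measurable_pi_apply i).comp measurable_snd

/-- The law of an i.i.d. sequence of uniform random variables. -/
noncomputable def iidUniform : Measure (ℕ → ℝ) := Measure.infinitePi (fun _ => uniform01)

instance : IsProbabilityMeasure iidUniform := by unfold iidUniform; infer_instance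

lemma map_cons : (uniform01.prod iidUniform).map cons = iidUniform := by
  refine Measure.eq_infinitePi _ fun s t ht => ?_
  rw [Measure.map_apply measurable_cons (MeasurableSet.pi s.countable_toSet fun i _ => ht i)]
  classical
  have hpre : cons ⁻¹' (Set.pi s t) = (if 0 ∈ s then t 0 else Set.univ) ×ˢ
      Set.pi (s.preimage Nat.succ (Nat.succ_injective.injOn)) (fun i => t (i + 1)) := by
    ext ⟨x, y⟩
    simp only [Set.mem_preimage, Set.mem_pi, Set.mem_prod, Finset.mem_coe, Finset.mem_preimage]
    constructor
    · intro H
      refine ⟨?_, fun i hi => H (i + 1) hi⟩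
      split_ifs with h0
      · exact H 0 h0
      · trivial
    · rintro ⟨H0, H⟩ i hi
      cases i with
      | zero => rw [if_pos hi] at H0; exact H0
      | succ i => exact H i hi
  rw [hpre, Measure.prod_prod, iidUniform, Measure.infinitePi_pi _ (fun i _ => ht (i + 1)),
    Finset.prod_preimage' Nat.succ s Nat.succ_injective.injOn (fun i => uniform01 (t i))]
  have hs : s.filter (· ∈ Set.range Nat.succ) = s.erase 0 := by
    ext i
    cases i <;> simp
  rw [hs]
  split_ifs with h0
  · rw [Finset.mul_prod_erase s (fun i => uniform01 (t i)) h0]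
  · rw [Finset.erase_eq_of_notMem h0, measure_univ, one_mul]

/-- The factor `U ^ (1 / θ)`. -/
noncomputable def fac (θ x : ℝ) : ENNReal := ENNReal.ofReal (x ^ (1 / θ))

/-- The product `(U₀ ⋯ Uⱼ) ^ (1 / θ)`. -/
noncomputable def term (θ : ℝ) (j : ℕ) (y : ℕ → ℝ) : ENNReal :=
  ∏ i ∈ Finset.range (j + 1), fac θ (y i)

/-- The perpetuity `∑ⱼ (U₀ ⋯ Uⱼ) ^ (1 / θ)`. -/
noncomputable def perp (θ : ℝ) (y : ℕ → ℝ) : ENNReal := ∑' j, term θ j y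

lemma measurable_fac (θ : ℝ) : Measurable (fac θ) := by unfold fac; fun_prop

lemma measurable_term (θ : ℝ) (j : ℕ) : Measurable (term θ j) := by
  unfold term
  exact Finset.measurable_prod _ fun i _ => (measurable_fac θ).comp (measurable_pi_apply i)

lemma measurable_perp (θ : ℝ) : Measurable (perp θ) :=
  Measurable.tsum fun j => measurable_term θ j

lemma term_succ_cons (θ : ℝ) (j : ℕ) (p : ℝ × (ℕ → ℝ)) :
    term θ (j + 1) (cons p) = fac θ p.1 * term θ j p.2 := by
  unfold term
  rw [Finset.prod_range_succ', mul_comm]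
  rfl

lemma perp_cons (θ : ℝ) (p : ℝ × (ℕ → ℝ)) :
    perp θ (cons p) = fac θ p.1 * (perp θ p.2 + 1) := by
  unfold perp
  rw [tsum_eq_zero_add' ENNReal.summable]
  simp only [term_succ_cons, ENNReal.tsum_mul_left]
  have : term θ 0 (cons p) = fac θ p.1 := by simp [term, cons]
  rw [this]
  ring

lemma lintegral_fac_lt_one {θ : ℝ} (hθ : 0 < θ) : ∫⁻ x, fac θ x ∂uniform01 < 1 := by
  have hpos : 0 < 1 / θ := by positivity
  unfold fac uniform01
  rw [← ofReal_integral_eq_lintegral_ofReal]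
  · rw [integral_Icc_eq_integral_Ioc, ← intervalIntegral.integral_of_le zero_le_one,
      integral_rpow (Or.inl (by linarith))]
    rw [Real.one_rpow, Real.zero_rpow (by linarith), sub_zero, ← ENNReal.ofReal_one]
    rw [ENNReal.ofReal_lt_ofReal_iff zero_lt_one, div_lt_one (by linarith)]
    linarith
  · exact (Real.continuous_rpow_const hpos.le).integrableOn_Icc
  · filter_upwards [ae_restrict_mem measurableSet_Icc] with x hx
    exact Real.rpow_nonneg hx.1 _

lemma lintegral_term (θ : ℝ) (j : ℕ) :
    ∫⁻ y, term θ j y ∂iidUniform = (∫⁻ x, fac θ x ∂uniform01) ^ (j + 1) := by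
  induction j with
  | zero =>
    rw [← map_cons, lintegral_map (measurable_term θ 0) measurable_cons]
    have : ∀ p : ℝ × (ℕ → ℝ), term θ 0 (cons p) = fac θ p.1 := by simp [term, cons]
    simp only [this, zero_add, pow_one]
    have hm : Measurable (fun p : ℝ × (ℕ → ℝ) => fac θ p.1) :=
      (measurable_fac θ).comp measurable_fst
    rw [lintegral_prod _ hm.aemeasurable]
    simp
  | succ j ih =>
    rw [← map_cons, lintegral_map (measurable_term θ _) measurable_cons]
    simp only [term_succ_cons]
    rw [lintegral_prod_mul (measurable_fac θ).aemeasurable (measurable_term θ j).aemeasurable,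
      ih, pow_succ' _ (j + 1)]

lemma ae_perp_lt_top {θ : ℝ} (hθ : 0 < θ) : ∀ᵐ y ∂iidUniform, perp θ y < ⊤ := by
  refine ae_lt_top (measurable_perp θ) ?_
  unfold perp
  rw [lintegral_tsum fun j => (measurable_term θ j).aemeasurable]
  simp only [lintegral_term]
  have h := lintegral_fac_lt_one hθ
  simp only [pow_succ]
  rw [ENNReal.tsum_mul_right, ENNReal.tsum_geometric]
  refine ENNReal.mul_ne_top (ENNReal.inv_ne_top.2 ?_) (h.trans ENNReal.one_lt_top).ne
  exact (tsub_pos_of_lt h).ne'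

lemma isDickman_perp {θ : ℝ} (hθ : 0 < θ) :
    IsDickman θ (iidUniform.map (fun y => (perp θ y).toReal)) := by
  have hm : Measurable (fun y => (perp θ y).toReal) := (measurable_perp θ).ennreal_toReal
  refine ⟨Measure.isProbabilityMeasure_map hm.aemeasurable, ?_, ?_⟩
  · rw [Measure.map_apply hm measurableSet_Iio]
    convert measure_empty (μ := iidUniform)
    ext y
    simp
  · have e1 : uniform01.prod (iidUniform.map (fun y => (perp θ y).toReal)) =
        (uniform01.prod iidUniform).map (Prod.map id (fun y => (perp θ y).toReal)) := by
      conv_lhs => rw [← Measure.map_id (μ := uniform01)]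
      exact Measure.map_prod_map _ _ measurable_id hm
    rw [dickmanTransform, e1, Measure.map_map (measurable_step θ) (measurable_id.prodMap hm)]
    conv_rhs => rw [← map_cons]
    rw [Measure.map_map hm measurable_cons]
    refine Measure.map_congr ?_
    have hfin : ∀ᵐ p ∂(uniform01.prod iidUniform), perp θ p.2 < ⊤ :=
      Measure.quasiMeasurePreserving_snd.ae (ae_perp_lt_top hθ)
    have hnn : ∀ᵐ p ∂(uniform01.prod iidUniform), (0 : ℝ) ≤ p.1 := by
      refine Measure.quasiMeasurePreserving_fst.ae (p := fun x : ℝ => 0 ≤ x) ?_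
      unfold uniform01
      filter_upwards [ae_restrict_mem measurableSet_Icc] with x hx using hx.1
    filter_upwards [hfin, hnn] with p hp hp0
    simp only [Function.comp_apply, Prod.map_fst, Prod.map_snd, id, perp_cons, fac]
    rw [ENNReal.toReal_mul, ENNReal.toReal_add hp.ne ENNReal.one_ne_top,
      ENNReal.toReal_ofReal (Real.rpow_nonneg hp0 _), ENNReal.toReal_one]

end DickmanAux

/-- There is exactly one non-negative fixed point (in distribution). -/
theorem existsUnique_isDickman {θ : ℝ} (hθ : 0 < θ) : ∃! μ : Measure ℝ, IsDickman θ μ :=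
  ⟨_, DickmanAux.isDickman_perp hθ, fun _ h => DickmanAux.unique hθ h (DickmanAux.isDickman_perp hθ)⟩

/-- The (generalized) Dickman distribution with parameter `θ > 0`, the law of `D_θ`: the unique
non-negative fixed point of `W ↦ U ^ (1 / θ) * (W + 1)`. -/
noncomputable def dickman {θ : ℝ} (hθ : 0 < θ) : Measure ℝ := (existsUnique_isDickman hθ).choose

theorem isDickman_dickman {θ : ℝ} (hθ : 0 < θ) : IsDickman θ (dickman hθ) :=
  (existsUnique_isDickman hθ).choose_spec.1

/-- The Kolmogorov distance between two laws on `[0, ∞)`: the supremum over `a ≥ 0` of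
`|μ (-∞, a] - ν (-∞, a]|`. -/
noncomputable def kolmogorovDist (μ ν : Measure ℝ) : ℝ :=
  ⨆ a : Set.Ici (0 : ℝ), |μ.real (Set.Iic (a : ℝ)) - ν.real (Set.Iic (a : ℝ))|

/-- For probability measures the supremum is over a bounded family. -/
theorem bddAbove_kolmogorovDist (μ ν : Measure ℝ) [IsProbabilityMeasure μ]
    [IsProbabilityMeasure ν] : BddAbove (Set.range fun a : Set.Ici (0 : ℝ) =>
      |μ.real (Set.Iic (a : ℝ)) - ν.real (Set.Iic (a : ℝ))|) := by
  refine ⟨1, ?_⟩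
  rintro _ ⟨a, rfl⟩
  refine abs_sub_le_iff.2 ⟨?_, ?_⟩ <;>
  linarith [measureReal_nonneg (μ := μ) (s := Set.Iic (a : ℝ)),
    measureReal_nonneg (μ := ν) (s := Set.Iic (a : ℝ)),
    measureReal_le_one (μ := μ) (s := Set.Iic (a : ℝ)),
    measureReal_le_one (μ := ν) (s := Set.Iic (a : ℝ))]

/-- The success probability `θ / (k + β)` lies in `[0, 1]` as soon as `k ≥ θ - β`. -/
theorem div_add_mem_unitInterval {θ β : ℝ} (hθ : 0 < θ) {l k : ℕ} (hl : θ - β ≤ l) (hk : l ≤ k) :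
    θ / (k + β) ∈ unitInterval := by
  have h : θ ≤ k + β := by
    have : (l : ℝ) ≤ k := Nat.cast_le.2 hk
    linarith
  exact ⟨div_nonneg hθ.le (hθ.le.trans h), div_le_one_of_le₀ h (hθ.le.trans h)⟩

/-- `B_l, …, B_n` are independent random variables on `(Ω, P)` with `B_k ∼ Ber(θ / (k + β))`,
i.e. `B_k` is `1` with probability `θ / (k + β)` and `0` otherwise. -/
structure IsBernoulliFamily {θ β : ℝ} (hθ : 0 < θ) {l : ℕ} (hl : θ - β ≤ l) (n : ℕ)
    {Ω : Type u} [MeasurableSpace Ω] (P : Measure Ω) (B : ℕ → Ω → ℝ) : Prop where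
  hasLaw : ∀ (k : ℕ) (hk : l ≤ k), k ≤ n → HasLaw (B k)
    (bernoulliMeasure (1 : ℝ) 0 ⟨θ / (k + β), div_add_mem_unitInterval hθ hl hk⟩) P
  indep : iIndepFun (fun (k : Finset.Icc l n) => B k) P

/-- `W_n = n⁻¹ ∑_{k=l}^n k B_k`. -/
noncomputable def weightedSum {Ω : Type u} (B : ℕ → Ω → ℝ) (l n : ℕ) (ω : Ω) : ℝ :=
  (n : ℝ)⁻¹ * ∑ k ∈ Finset.Icc l n, (k : ℝ) * B k ω

namespace DickmanKolmogorov

open Set Filter Topology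


/-! The proof is a stability argument for a delay equation. Write `F` for a distribution function on
`[0, ∞)` and `Φ(a) = ∫_0^a F`, so that `a F(a) - Φ(a) = E[X; X ≤ a]`. Averaging an elementary
identity for the law of `U ^ (1 / θ) * c` over `c = W + 1` turns the fixed point equation into `E[W;
W ≤ a] = θ ∫_{a-1}^a F`, that is `(1 + θ) Φ(a) = a Φ'(a) + θ Φ(a - 1)` (`cdfInt_dickman`). For
another law, `dickmanDefect` is the difference of the two sides.

Stability (`abs_deriv_le_of_delay`): if the defect is at most `η min(a, 1)`, the difference `f` of
the two functions `Φ` is bounded and solves the equation with a perturbation of that size.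
Integration from infinity with the factor `y ^ (-(1 + θ))` gives `sup |f| ≤ (η + θ sup |f|) / (1 +
θ)`, hence `sup |f| ≤ η`. Solving for `f'` then bounds the difference of the distribution functions
by a multiple of `η`. Near `0` this divides by `a`, which is why the defect must be `O(a)` there.

For `S = ∑ k B_k` with distribution function `G`, size biasing gives `E[S; S ≤ x] = ∑ k p_k G_k(x -
k)`, where `G_k` belongs to the sum without `B_k`. Since `k p_k = θ - θβ / (k + β)`, the defect
splits (`sumDefect_eq`) into a Riemann sum error, at most a multiple of `l G(x)`; a dependence term
from replacing `G_k` by `G`; and a shift term with weights `1 / (k + β)`, the source of the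
logarithm. All are controlled by the lower tail `G(x) = O((x / n) ^ θ)` for `l ≤ x ≤ n`, because `S
≤ x` forces all `B_k` with `k > x` to vanish. For `θ ≥ 1` the dependence term also needs the atom
bound `P(S = m) = O(l / n)`, a second use of size biasing. For `θ < 1` it is bounded crudely by the
shift term, and `log (z / l)` is absorbed in `(z / l) ^ (1 - θ)`.

Lower bounds: `S` is integer valued, so its distribution function is flat between lattice points
while the Dickman one equals `c a ^ θ` on `[0, 1]`. Its growth just above `0` gives order `n ^
(-θ)`, its growth just below `1` gives order `1 / n`. The logarithm comes from reading the defect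
equation backwards: a small distance forces a small defect (`abs_defect_le`), whereas at a fixed
large `a` the shift term is at least of order `log n` and the other terms stay bounded for fixed
`l`. -/

/-! ### Integrated distribution functions -/

/-- The integrated distribution function `a ↦ ∫_0^a μ (-∞, y] dy`. -/
noncomputable def cdfInt (μ : Measure ℝ) (a : ℝ) : ℝ := ∫ y in (0 : ℝ)..a, cdf μ y

lemma intervalIntegrable_cdf (μ : Measure ℝ) (a b : ℝ) :
    IntervalIntegrable (cdf μ) volume a b :=
  (monotone_cdf μ).intervalIntegrable

lemma hasDerivWithinAt_cdfInt (μ : Measure ℝ) (a : ℝ) :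
    HasDerivWithinAt (cdfInt μ) (cdf μ a) (Ici a) a := by
  unfold cdfInt
  refine intervalIntegral.integral_hasDerivWithinAt_right (intervalIntegrable_cdf μ _ _)
    (t := Ioi a) ?_ ?_
  · exact ((monotone_cdf μ).measurable.stronglyMeasurable).stronglyMeasurableAtFilter
  · exact ((cdf μ).right_continuous a).mono Ioi_subset_Ici_self

lemma continuous_cdfInt (μ : Measure ℝ) : Continuous (cdfInt μ) :=
  intervalIntegral.continuous_primitive (fun a b => intervalIntegrable_cdf μ a b) 0

lemma cdfInt_sub (μ : Measure ℝ) (a b : ℝ) :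
    cdfInt μ b - cdfInt μ a = ∫ y in a..b, cdf μ y := by
  unfold cdfInt
  exact intervalIntegral.integral_interval_sub_left (intervalIntegrable_cdf μ _ _)
    (intervalIntegrable_cdf μ _ _)

lemma cdfInt_zero (μ : Measure ℝ) : cdfInt μ 0 = 0 := by simp [cdfInt]

lemma ae_nonneg_of_Iio {μ : Measure ℝ} (h : μ (Iio 0) = 0) : ∀ᵐ x ∂μ, 0 ≤ x := by
  rw [ae_iff]
  simpa [Iio] using h

lemma cdfInt_le (μ : Measure ℝ) {a : ℝ} (ha : 0 ≤ a) : cdfInt μ a ≤ a := by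
  unfold cdfInt
  calc ∫ y in (0 : ℝ)..a, cdf μ y ≤ ∫ y in (0 : ℝ)..a, (1 : ℝ) :=
        intervalIntegral.integral_mono_on ha (intervalIntegrable_cdf μ _ _) (by simp)
          fun y _ => cdf_le_one μ y
    _ = a := by simp

section

variable {μ : Measure ℝ} [IsProbabilityMeasure μ]

lemma cdf_eq_zero_of_neg (h : μ (Iio 0) = 0) {y : ℝ} (hy : y < 0) : cdf μ y = 0 := by
  rw [cdf_eq_real, measureReal_def, measure_mono_null (Iic_subset_Iio.2 hy) h]
  rfl

lemma cdfInt_of_nonpos (h : μ (Iio 0) = 0) {a : ℝ} (ha : a ≤ 0) : cdfInt μ a = 0 := by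
  unfold cdfInt
  rw [intervalIntegral.integral_symm, intervalIntegral.integral_of_le ha,
    integral_Ioc_eq_integral_Ioo, setIntegral_congr_fun (g := fun _ => 0) measurableSet_Ioo]
  · simp
  · exact fun y hy => cdf_eq_zero_of_neg h hy.2

/-- Fubini for bounded kernels. -/
lemma intervalIntegral_integral_swap_of_bound {f : ℝ → ℝ → ℝ} {a C : ℝ}
    (hf : Measurable (Function.uncurry f)) (hC : ∀ y x, |f y x| ≤ C) :
    ∫ y in (0 : ℝ)..a, (∫ x, f y x ∂μ) = ∫ x, (∫ y in (0 : ℝ)..a, f y x) ∂μ := by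
  have : IsFiniteMeasure (volume.restrict (uIoc 0 a)) := by rw [uIoc]; infer_instance
  have hi : Integrable (Function.uncurry f) ((volume.restrict (uIoc 0 a)).prod μ) :=
    Integrable.of_bound hf.aestronglyMeasurable C (Eventually.of_forall fun p => hC _ _)
  exact intervalIntegral_integral_swap hi

lemma cdf_eq_integral (y : ℝ) : cdf μ y = ∫ x, (if x ≤ y then 1 else 0 : ℝ) ∂μ := by
  rw [cdf_eq_real, ← integral_indicator_one measurableSet_Iic]
  rfl

lemma intervalIntegral_ite_le {x a : ℝ} (hx : 0 ≤ x) (ha : 0 ≤ a) :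
    ∫ y in (0 : ℝ)..a, (if x ≤ y then 1 else 0 : ℝ) = max (a - x) 0 := by
  rw [intervalIntegral.integral_of_le ha, integral_Ioc_eq_integral_Ioo,
    ← integral_Ico_eq_integral_Ioo]
  have : (fun y : ℝ => (if x ≤ y then 1 else 0 : ℝ)) = indicator (Ici x) 1 := by
    ext y; simp [indicator]
  rw [this, setIntegral_indicator measurableSet_Ici]
  have h2 : Ico 0 a ∩ Ici x = Ico x a := by
    ext y; simp only [mem_inter_iff, mem_Ico, mem_Ici]; constructor
    · rintro ⟨⟨_, h⟩, h'⟩; exact ⟨h', h⟩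
    · rintro ⟨h, h'⟩; exact ⟨⟨hx.trans h, h'⟩, h⟩
  rw [h2]
  simp [measureReal_def, ENNReal.toReal_ofReal']

lemma cdfInt_eq_integral (h : μ (Iio 0) = 0) (a : ℝ) :
    cdfInt μ a = ∫ x, max (a - x) 0 ∂μ := by
  rcases lt_or_ge a 0 with ha | ha
  · rw [cdfInt_of_nonpos h ha.le]
    symm
    have h0 : (fun x => max (a - x) 0) =ᵐ[μ] 0 := by
      filter_upwards [ae_nonneg_of_Iio h] with x hx
      exact max_eq_right (by linarith)
    exact integral_eq_zero_of_ae h0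
  · unfold cdfInt
    simp_rw [cdf_eq_integral]
    rw [intervalIntegral_integral_swap_of_bound (C := 1)]
    · refine integral_congr_ae ?_
      filter_upwards [ae_nonneg_of_Iio h] with x hx using intervalIntegral_ite_le hx ha
    · exact Measurable.ite (measurableSet_le measurable_snd measurable_fst)
        measurable_const measurable_const
    · intro y x
      split_ifs <;> simp

/-- The truncated mean in terms of the distribution function. -/
lemma mul_cdf_sub_cdfInt (h : μ (Iio 0) = 0) (a : ℝ) :
    a * cdf μ a - cdfInt μ a = ∫ x, (if x ≤ a then x else 0) ∂μ := by
  rw [cdfInt_eq_integral h, cdf_eq_integral, ← integral_const_mul, ← integral_sub]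
  · congr 1
    ext x
    split_ifs with hx
    · rw [max_eq_left (by linarith)]; ring
    · rw [max_eq_right (by linarith [not_le.1 hx])]; ring
  · refine Integrable.of_bound (C := |a|) ?_ (Eventually.of_forall fun x => ?_)
    · exact (Measurable.const_mul (Measurable.ite measurableSet_Iic measurable_const
        measurable_const) a).aestronglyMeasurable
    · split_ifs <;> simp
  · refine Integrable.of_bound (C := |a|) (by fun_prop) ?_
    filter_upwards [ae_nonneg_of_Iio h] with x hx
    rw [Real.norm_eq_abs, abs_of_nonneg (le_max_right _ _)]
    exact max_le (by linarith [le_abs_self a]) (abs_nonneg a)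

lemma sub_cdfInt_eq (h : μ (Iio 0) = 0) (a : ℝ) :
    a - cdfInt μ a = ∫ x, min x a ∂μ := by
  have e : a = ∫ _, a ∂μ := by simp
  rw [cdfInt_eq_integral h]
  conv_lhs => rw [e]
  rw [← integral_sub (integrable_const a)]
  · congr 1
    ext x
    rw [← e]
    rcases le_total x a with hx | hx
    · rw [max_eq_left (by linarith), min_eq_left hx]; ring
    · rw [max_eq_right (by linarith), min_eq_right hx]; ring
  · rw [← e]
    refine Integrable.of_bound (C := |a|) (by fun_prop) ?_
    filter_upwards [ae_nonneg_of_Iio h] with x hx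
    rw [Real.norm_eq_abs, abs_of_nonneg (le_max_right _ _)]
    exact max_le (by linarith [le_abs_self a]) (abs_nonneg a)

/-- If the truncated means are at most `M`, then so is `∫ min x a`. -/
lemma sub_cdfInt_le_of_truncated (h : μ (Iio 0) = 0) {M : ℝ}
    (hM : ∀ a, a * cdf μ a - cdfInt μ a ≤ M) {a : ℝ} (ha : 0 ≤ a) :
    a - cdfInt μ a ≤ M := by
  have htend : Tendsto (fun b : ℝ => M + a * (1 - cdf μ b)) atTop (𝓝 (M + a * (1 - 1))) :=
    tendsto_const_nhds.add ((tendsto_const_nhds.sub (tendsto_cdf_atTop μ)).const_mul a)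
  simp only [sub_self, mul_zero, add_zero] at htend
  refine ge_of_tendsto' htend fun b => ?_
  have hi1 : Integrable (fun x => (if x ≤ b then x else 0 : ℝ)) μ := by
    refine Integrable.of_bound (C := |b|) ?_ ?_
    · exact (Measurable.ite measurableSet_Iic measurable_id measurable_const).aestronglyMeasurable
    · filter_upwards [ae_nonneg_of_Iio h] with x hx
      split_ifs with hxb
      · rw [Real.norm_eq_abs, abs_of_nonneg hx]; exact hxb.trans (le_abs_self b)
      · simp
  have hi2 : Integrable (fun x => (if x ≤ b then 1 else 0 : ℝ)) μ := by
    refine Integrable.of_bound (C := 1) ?_ (Eventually.of_forall fun x => ?_)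
    · exact (Measurable.ite measurableSet_Iic measurable_const
        measurable_const).aestronglyMeasurable
    · split_ifs <;> simp
  have hi3 : Integrable (fun x => a * (1 - (if x ≤ b then 1 else 0 : ℝ))) μ :=
    ((integrable_const 1).sub hi2).const_mul a
  have e : ∫ x, (if x ≤ b then x else 0) + a * (1 - (if x ≤ b then 1 else 0 : ℝ)) ∂μ
      = (b * cdf μ b - cdfInt μ b) + a * (1 - cdf μ b) := by
    rw [integral_add hi1 hi3, integral_const_mul, integral_sub (integrable_const 1) hi2,
      ← cdf_eq_integral, ← mul_cdf_sub_cdfInt h]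
    simp
  -- Pointwise `min x a ≤ x 1_{x ≤ b} + a 1_{x > b}`; the last part disappears as `b → ∞`, so
  -- integrability of `x` is never assumed.
  have hle : a - cdfInt μ a ≤
      ∫ x, (if x ≤ b then x else 0) + a * (1 - (if x ≤ b then 1 else 0 : ℝ)) ∂μ := by
    rw [sub_cdfInt_eq h]
    refine integral_mono_ae ?_ (hi1.add hi3) ?_
    · refine Integrable.of_bound (C := a) (by fun_prop) ?_
      filter_upwards [ae_nonneg_of_Iio h] with x hx
      rw [Real.norm_eq_abs, abs_of_nonneg (le_min hx ha)]
      exact min_le_right _ _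
    · filter_upwards with x
      by_cases hxb : x ≤ b
      · simp [hxb]
      · simp [hxb]
  linarith [hM b]

end


/-! ### The distribution function of the Dickman law -/

/-- The probability that `U ^ (1 / θ) * c ≤ y`, for `U` uniform on `[0, 1]`. -/
noncomputable def powerCdf (θ c y : ℝ) : ℝ := min 1 ((y / c) ^ θ)

lemma uniform01_rpow_le {θ c y : ℝ} (hθ : 0 < θ) (hc : 0 < c) (hy : 0 ≤ y) :
    uniform01 {u | u ^ (1 / θ) * c ≤ y} = ENNReal.ofReal (powerCdf θ c y) := by
  have hyc : 0 ≤ y / c := by positivity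
  have hm : MeasurableSet {u : ℝ | u ^ (1 / θ) * c ≤ y} :=
    measurableSet_le (by fun_prop) measurable_const
  rw [uniform01, Measure.restrict_apply hm]
  have : {u : ℝ | u ^ (1 / θ) * c ≤ y} ∩ Icc 0 1 = Icc 0 (powerCdf θ c y) := by
    ext u
    simp only [powerCdf, mem_inter_iff, mem_ofPred_eq, mem_Icc, le_min_iff]
    have key : 0 ≤ u → (u ^ (1 / θ) * c ≤ y ↔ u ≤ (y / c) ^ θ) := by
      intro hu
      rw [← le_div_iff₀ hc, one_div, Real.rpow_inv_le_iff_of_pos hu hyc hθ]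
    constructor
    · rintro ⟨h1, h2, h3⟩; exact ⟨h2, h3, (key h2).1 h1⟩
    · rintro ⟨h2, h3, h1⟩; exact ⟨(key h2).2 h1, h2, h3⟩
  rw [this]
  simp

lemma measurable_powerCdf (θ : ℝ) :
    Measurable (Function.uncurry fun y x => powerCdf θ (x + 1) y) := by
  unfold powerCdf Function.uncurry
  fun_prop

lemma abs_powerCdf_le {θ c y : ℝ} (hc : 0 ≤ c) (hy : 0 ≤ y) : |powerCdf θ c y| ≤ 1 := by
  unfold powerCdf
  rw [abs_of_nonneg (le_min zero_le_one (Real.rpow_nonneg (div_nonneg hy hc) _))]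
  exact min_le_left _ _

lemma integrable_powerCdf {μ : Measure ℝ} [IsProbabilityMeasure μ] (h : μ (Iio 0) = 0) {θ a : ℝ}
    (ha : 0 ≤ a) : Integrable (fun x => powerCdf θ (x + 1) a) μ := by
  refine Integrable.of_bound (C := 1) ?_ ?_
  · exact ((measurable_powerCdf θ).comp measurable_prodMk_left).aestronglyMeasurable
  · filter_upwards [ae_nonneg_of_Iio h] with x hx
    exact abs_powerCdf_le (by linarith) ha

lemma cdf_dickman_eq_integral {θ : ℝ} (hθ : 0 < θ) {μ : Measure ℝ} (h : IsDickman θ μ) {a : ℝ}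
    (ha : 0 ≤ a) : cdf μ a = ∫ x, powerCdf θ (x + 1) a ∂μ := by
  have := h.isProbabilityMeasure
  have hm := DickmanAux.measurable_step θ
  have hnn : ∀ᵐ x ∂μ, 0 ≤ powerCdf θ (x + 1) a := by
    filter_upwards [ae_nonneg_of_Iio h.nonneg] with x hx
    exact le_min zero_le_one (Real.rpow_nonneg (by positivity) _)
  rw [integral_eq_lintegral_of_nonneg_ae hnn (integrable_powerCdf h.nonneg ha).1, cdf_eq_real,
    measureReal_def]
  congr 1
  conv_lhs => rw [← h.fixed]
  rw [dickmanTransform, Measure.map_apply hm measurableSet_Iic,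
    Measure.prod_apply_symm (hm measurableSet_Iic)]
  refine lintegral_congr_ae ?_
  filter_upwards [ae_nonneg_of_Iio h.nonneg] with x hx
  exact uniform01_rpow_le (c := x + 1) hθ (by linarith) ha

lemma intervalIntegral_powerCdf_of_le {θ c a : ℝ} (hθ : 0 < θ) (hc : 0 < c) (ha : 0 ≤ a)
    (hac : a ≤ c) : ∫ y in (0 : ℝ)..a, powerCdf θ c y = a * (a / c) ^ θ / (1 + θ) := by
  have e : ∫ y in (0 : ℝ)..a, powerCdf θ c y = ∫ y in (0 : ℝ)..a, y ^ θ * (c ^ θ)⁻¹ := by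
    refine intervalIntegral.integral_congr fun y hy => ?_
    rw [uIcc_of_le ha] at hy
    have h1 : (y / c) ^ θ ≤ 1 :=
      Real.rpow_le_one (div_nonneg hy.1 hc.le) ((div_le_one hc).2 (hy.2.trans hac)) hθ.le
    simp only [powerCdf, min_eq_right h1]
    rw [Real.div_rpow hy.1 hc.le, div_eq_mul_inv]
  rw [e, intervalIntegral.integral_mul_const, integral_rpow (Or.inl (by linarith)),
    Real.zero_rpow (by linarith), Real.div_rpow ha hc.le]
  have : a ^ (θ + 1) = a * a ^ θ := by
    rcases ha.eq_or_lt with rfl | ha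
    · rw [Real.zero_rpow (by linarith), zero_mul]
    · rw [Real.rpow_add ha, Real.rpow_one, mul_comm]
  rw [this]
  have : c ^ θ ≠ 0 := (Real.rpow_pos_of_pos hc θ).ne'
  field_simp
  ring

lemma intervalIntegrable_powerCdf {θ c a b : ℝ} (hθ : 0 < θ) :
    IntervalIntegrable (powerCdf θ c) volume a b := by
  refine Continuous.intervalIntegrable ?_ _ _
  have : Continuous fun x : ℝ => x ^ θ := Real.continuous_rpow_const hθ.le
  unfold powerCdf
  exact continuous_const.min (this.comp (by fun_prop))

/-- With `g = powerCdf θ c`, one has `y g' = θ g` below `c` and `g = 1` above it, so `(1 + θ) g - (y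
g)'` is `0` below `c` and `θ` above. The last term, with `c = W + 1`, becomes the delayed one. -/
lemma intervalIntegral_powerCdf {θ c a : ℝ} (hθ : 0 < θ) (hc : 0 < c) (ha : 0 ≤ a) :
    (1 + θ) * ∫ y in (0 : ℝ)..a, powerCdf θ c y = a * powerCdf θ c a + θ * max (a - c) 0 := by
  rcases le_total a c with hac | hac
  · have h1 : (a / c) ^ θ ≤ 1 :=
      Real.rpow_le_one (div_nonneg ha hc.le) ((div_le_one hc).2 hac) hθ.le
    rw [intervalIntegral_powerCdf_of_le hθ hc ha hac, max_eq_right (by linarith), powerCdf,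
      min_eq_right h1]
    field_simp
    ring
  · rw [← intervalIntegral.integral_add_adjacent_intervals (b := c)
      (intervalIntegrable_powerCdf hθ) (intervalIntegrable_powerCdf hθ),
      intervalIntegral_powerCdf_of_le hθ hc hc.le le_rfl]
    have one : ∀ y, c ≤ y → powerCdf θ c y = 1 := fun y hy =>
      min_eq_left (Real.one_le_rpow ((one_le_div hc).2 hy) hθ.le)
    have e : ∫ y in c..a, powerCdf θ c y = ∫ y in c..a, (1 : ℝ) := by
      refine intervalIntegral.integral_congr fun y hy => ?_
      rw [uIcc_of_le hac] at hy
      exact one y hy.1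
    rw [e, one a hac, max_eq_left (by linarith), div_self hc.ne', Real.one_rpow]
    simp only [intervalIntegral.integral_const, smul_eq_mul, mul_one]
    field_simp
    ring

/-- The average of `intervalIntegral_powerCdf` over `c = W + 1`, in which `E max(a - 1 - W, 0)` is
the integrated distribution function at `a - 1`. -/
lemma cdfInt_dickman {θ : ℝ} (hθ : 0 < θ) {μ : Measure ℝ} (h : IsDickman θ μ) {a : ℝ}
    (ha : 0 ≤ a) : (1 + θ) * cdfInt μ a = a * cdf μ a + θ * cdfInt μ (a - 1) := by
  have := h.isProbabilityMeasure
  -- The absolute values make the kernel bounded on the whole plane, as the Fubini lemma demands;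
  -- they change nothing on the relevant range `x, y ≥ 0`.
  have e1 : cdfInt μ a = ∫ x, (∫ y in (0 : ℝ)..a, powerCdf θ (|x| + 1) |y|) ∂μ := by
    have hm : Measurable (Function.uncurry fun y x : ℝ => powerCdf θ (|x| + 1) |y|) := by
      unfold powerCdf Function.uncurry
      fun_prop
    rw [← intervalIntegral_integral_swap_of_bound (C := 1) hm
      fun y x => abs_powerCdf_le (by positivity) (abs_nonneg y)]
    refine intervalIntegral.integral_congr fun y hy => ?_
    rw [uIcc_of_le ha] at hy
    simp only [cdf_dickman_eq_integral hθ h hy.1, abs_of_nonneg hy.1]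
    refine integral_congr_ae ?_
    filter_upwards [ae_nonneg_of_Iio h.nonneg] with x hx
    rw [abs_of_nonneg hx]
  rw [e1, cdf_dickman_eq_integral hθ h ha, cdfInt_eq_integral h.nonneg, ← integral_const_mul,
    ← integral_const_mul, ← integral_const_mul, ← integral_add]
  · refine integral_congr_ae ?_
    filter_upwards [ae_nonneg_of_Iio h.nonneg] with x hx
    rw [abs_of_nonneg hx]
    have e2 : ∫ y in (0 : ℝ)..a, powerCdf θ (x + 1) |y| = ∫ y in (0 : ℝ)..a, powerCdf θ (x + 1) y := by
      refine intervalIntegral.integral_congr fun y hy => ?_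
      rw [uIcc_of_le ha] at hy
      simp only [abs_of_nonneg hy.1]
    rw [e2, intervalIntegral_powerCdf hθ (by linarith) ha, sub_sub, add_comm 1 x]
  · exact (integrable_powerCdf h.nonneg ha).const_mul a
  · refine Integrable.of_bound (C := θ * a) (by fun_prop) ?_
    filter_upwards [ae_nonneg_of_Iio h.nonneg] with x hx
    rw [Real.norm_eq_abs, abs_of_nonneg (by positivity)]
    gcongr
    exact max_le (by linarith) ha

/-- By the delay equation the truncated means equal `θ` times the integral of the distribution
function over a unit interval, hence are at most `θ`. This supplies the boundedness needed for the
stability argument. -/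
lemma sub_cdfInt_dickman_le {θ : ℝ} (hθ : 0 < θ) {μ : Measure ℝ} (h : IsDickman θ μ) {a : ℝ}
    (ha : 0 ≤ a) : a - cdfInt μ a ≤ θ := by
  have := h.isProbabilityMeasure
  refine sub_cdfInt_le_of_truncated h.nonneg (fun b => ?_) ha
  rcases le_or_gt 0 b with hb | hb
  · have h1 := cdfInt_dickman hθ h hb
    have h2 : cdfInt μ b - cdfInt μ (b - 1) ≤ 1 := by
      rw [cdfInt_sub]
      calc ∫ y in (b - 1)..b, cdf μ y ≤ ∫ y in (b - 1)..b, (1 : ℝ) :=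
            intervalIntegral.integral_mono_on (by linarith) (intervalIntegrable_cdf μ _ _) (by simp)
              fun y _ => cdf_le_one μ y
        _ = 1 := by simp
    nlinarith
  · rw [cdfInt_of_nonpos h.nonneg hb.le, cdf_eq_zero_of_neg h.nonneg hb]
    simpa using hθ.le

/-- On `[0, 1]` the Dickman distribution function is a multiple of `a ^ θ`. -/
lemma exists_cdf_dickman_eq {θ : ℝ} (hθ : 0 < θ) {μ : Measure ℝ} (h : IsDickman θ μ) :
    ∃ c : ℝ, 0 < c ∧ ∀ a, 0 ≤ a → a ≤ 1 → cdf μ a = c * a ^ θ := by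
  have := h.isProbabilityMeasure
  have hpow : ∀ᵐ x ∂μ, 0 < (1 / (x + 1)) ^ θ := by
    filter_upwards [ae_nonneg_of_Iio h.nonneg] with x hx
    exact Real.rpow_pos_of_pos (by positivity) _
  have hint : Integrable (fun x : ℝ => (1 / (x + 1)) ^ θ) μ := by
    have hm : Measurable fun x : ℝ => (1 / (x + 1)) ^ θ := Measurable.pow_const (by fun_prop) θ
    refine Integrable.of_bound (C := 1) hm.aestronglyMeasurable ?_
    filter_upwards [ae_nonneg_of_Iio h.nonneg, hpow] with x hx hp
    rw [Real.norm_eq_abs, abs_of_pos hp]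
    exact Real.rpow_le_one (by positivity) ((div_le_one (by linarith)).2 (by linarith)) hθ.le
  -- The constant is `E (W + 1) ^ (-θ)`: for `a ≤ 1 ≤ W + 1` the minimum in `powerCdf` is always the
  -- power.
  refine ⟨∫ x, (1 / (x + 1)) ^ θ ∂μ, ?_, fun a ha ha1 => ?_⟩
  · rw [integral_pos_iff_support_of_nonneg_ae (hpow.mono fun x hx => hx.le) hint]
    have : Function.support (fun x : ℝ => (1 / (x + 1)) ^ θ) =ᵐ[μ] univ := by
      filter_upwards [hpow] with x hx
      exact eq_true (Function.mem_support.2 hx.ne')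
    rw [measure_congr this, measure_univ]
    exact one_pos
  · rw [cdf_dickman_eq_integral hθ h ha, ← integral_mul_const]
    refine integral_congr_ae ?_
    filter_upwards [ae_nonneg_of_Iio h.nonneg] with x hx
    rw [← Real.mul_rpow (by positivity) ha, powerCdf, min_eq_right, one_div_mul_eq_div]
    exact Real.rpow_le_one (by positivity) ((div_le_one (by linarith)).2 (by linarith)) hθ.le


/-! ### Stability of the delay equation -/

/-- Integration of a differential inequality with the integrating factor `y ^ (-q)`. -/
lemma abs_le_of_abs_mul_deriv_sub_le {f f' : ℝ → ℝ} {q s E a b : ℝ} (hs : s < q) (hE : 0 ≤ E)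
    (hf : Continuous f) (hf' : ∀ y, HasDerivWithinAt f (f' y) (Ici y) y) (ha : 0 < a) (hab : a ≤ b)
    (h : ∀ y, a ≤ y → y < b → |y * f' y - q * f y| ≤ E * y ^ s) :
    |f a| ≤ |f b| * (a / b) ^ q + E / (q - s) * a ^ s := by
  have hb : 0 < b := ha.trans_le hab
  have ht : 0 < q - s := sub_pos.2 hs
  have hpos : ∀ y ∈ Icc a b, 0 < y := fun y hy => ha.trans_le hy.1
  have hB : ∀ y, 0 < y → HasDerivAt (fun y => E / (q - s) * (a ^ (-(q - s)) - y ^ (-(q - s))))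
      (E * y ^ (-(q - s) - 1)) y := by
    intro y hy
    have := ((Real.hasDerivAt_rpow_const (p := -(q - s)) (Or.inl hy.ne')).const_sub
      (a ^ (-(q - s)))).const_mul (E / (q - s))
    refine this.congr_deriv ?_
    have := ht.ne'
    field_simp
  -- The derivative of `y ^ (-q) f(y)` is `y ^ (-q - 1) (y f' - q f)`, bounded by `E y ^ (s - q -
  -- 1)`. As `s < q` this is integrable at infinity, so the final bound survives `b → ∞`.
  have key := image_norm_le_of_norm_deriv_right_le_deriv_boundary'
    (f := fun y => y ^ (-q) * f y - a ^ (-q) * f a) (a := a) (b := b)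
    (f' := fun y => -q * y ^ (-q - 1) * f y + y ^ (-q) * f' y)
    (B := fun y => E / (q - s) * (a ^ (-(q - s)) - y ^ (-(q - s))))
    (B' := fun y => E * y ^ (-(q - s) - 1)) ?_ ?_ ?_ ?_ ?_ ?_ (right_mem_Icc.2 hab)
  · have h1 : |a ^ (-q) * f a| ≤ |b ^ (-q) * f b| + E / (q - s) * a ^ (-(q - s)) := by
      have h2 : 0 ≤ E / (q - s) * b ^ (-(q - s)) := by positivity
      have h3 := abs_sub_abs_le_abs_sub (a ^ (-q) * f a) (b ^ (-q) * f b)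
      rw [abs_sub_comm] at h3
      rw [Real.norm_eq_abs] at key
      linarith
    rw [abs_mul, abs_mul, abs_of_pos (Real.rpow_pos_of_pos ha _),
      abs_of_pos (Real.rpow_pos_of_pos hb _)] at h1
    have h4 := mul_le_mul_of_nonneg_left h1 (Real.rpow_pos_of_pos ha q).le
    rw [Real.div_rpow ha.le hb.le]
    have h5 : a ^ q * a ^ (-q) = 1 := by rw [← Real.rpow_add ha]; simp
    have h6 : a ^ q * a ^ (-(q - s)) = a ^ s := by rw [← Real.rpow_add ha]; congr 1; ring
    calc |f a| = a ^ q * (a ^ (-q) * |f a|) := by rw [← mul_assoc, h5, one_mul]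
      _ ≤ _ := h4
      _ = |f b| * (a ^ q * b ^ (-q)) + E / (q - s) * (a ^ q * a ^ (-(q - s))) := by ring
      _ = _ := by rw [h6, Real.rpow_neg hb.le, div_eq_mul_inv (a ^ q)]
  · refine ContinuousOn.sub (ContinuousOn.mul ?_ hf.continuousOn) continuousOn_const
    exact continuousOn_id.rpow_const fun y hy => Or.inl (hpos y hy).ne'
  · intro y hy
    have hy0 := hpos y ⟨hy.1, hy.2.le⟩
    exact (((Real.hasDerivAt_rpow_const (p := -q) (Or.inl hy0.ne')).hasDerivWithinAt).mul
      (hf' y)).sub_const _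
  · simp
  · exact fun y hy => (hB y (hpos y hy)).continuousAt.continuousWithinAt
  · exact fun y hy => (hB y (hpos y ⟨hy.1, hy.2.le⟩)).hasDerivWithinAt
  · intro y hy
    have hy0 := hpos y ⟨hy.1, hy.2.le⟩
    have e : -q * y ^ (-q - 1) * f y + y ^ (-q) * f' y
        = y ^ (-q - 1) * (y * f' y - q * f y) := by
      have : y ^ (-q) = y ^ (-q - 1) * y := by
        conv_rhs => rw [← Real.rpow_add_one hy0.ne']
        ring_nf
      rw [this]; ring
    have hp := Real.rpow_pos_of_pos hy0 (-q - 1)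
    simp only [e]
    rw [Real.norm_eq_abs, abs_mul, abs_of_pos hp]
    calc y ^ (-q - 1) * |y * f' y - q * f y| ≤ y ^ (-q - 1) * (E * y ^ s) := by
          gcongr; exact h y hy.1 hy.2
      _ = E * (y ^ (-q - 1) * y ^ s) := by ring
      _ = _ := by rw [← Real.rpow_add hy0]; ring_nf

lemma tendsto_const_mul_div_rpow_atTop (M a : ℝ) {q : ℝ} (hq : 0 < q) :
    Tendsto (fun b : ℝ => M * (a / b) ^ q) atTop (𝓝 0) := by
  have h1 : Tendsto (fun b : ℝ => a / b) atTop (𝓝 0) := tendsto_const_nhds.div_atTop tendsto_id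
  have h2 := (h1.rpow_const (Or.inr hq.le)).const_mul M
  rwa [Real.zero_rpow hq.ne', mul_zero] at h2

/-- A bounded function whose right derivative `f'` satisfies
`a f'(a) = (1 + θ) f(a) - θ f(a - 1) + O(η min (a, 1))` has `f' = O(η)`. -/
lemma abs_deriv_le_of_delay {f f' r : ℝ → ℝ} {θ M η : ℝ} (hθ : 0 < θ) (hη : 0 ≤ η)
    (hf : Continuous f) (hf' : ∀ y, HasDerivWithinAt f (f' y) (Ici y) y) (h0 : ∀ y ≤ 0, f y = 0)
    (hM : ∀ y, |f y| ≤ M) (hr : ∀ y, 0 ≤ y → |r y| ≤ η * min y 1)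
    (hdelay : ∀ y, 0 ≤ y → y * f' y = (1 + θ) * f y - θ * f (y - 1) + r y) {a : ℝ} (ha : 0 < a) :
    |f' a| ≤ (3 + 2 * θ + 1 / θ) * η := by
  -- Treat the delayed term as part of the error, of size at most `θ S`, and integrate from
  -- infinity, where boundedness of `f` kills the boundary term. The result is `S ≤ (η + θ S) / (1 +
  -- θ)`, so `M` leaves no trace in the bound.
  have hsup : ∀ y, |f y| ≤ η := by
    have hbdd : BddAbove (range fun y => |f y|) := ⟨M, by rintro _ ⟨y, rfl⟩; exact hM y⟩
    set S := ⨆ y, |f y| with hS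
    have hle : ∀ y, |f y| ≤ S := fun y => le_ciSup hbdd y
    have hS0 : 0 ≤ S := (abs_nonneg _).trans (hle 0)
    have step : ∀ y, |f y| ≤ (η + θ * S) / (1 + θ) := by
      intro y
      rcases le_or_gt y 0 with hy | hy
      · rw [h0 y hy, abs_zero]; positivity
      · have hb : ∀ b, y ≤ b → |f y| ≤ M * (y / b) ^ (1 + θ) + (η + θ * S) / (1 + θ) := by
          intro b hyb
          have := abs_le_of_abs_mul_deriv_sub_le (q := 1 + θ) (s := 0) (E := η + θ * S)
            (by linarith) (by positivity) hf hf' hy hyb (fun z hz _ => by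
              rw [hdelay z (hy.le.trans hz), Real.rpow_zero, mul_one]
              have h1 := hr z (hy.le.trans hz)
              have h2 : η * min z 1 ≤ η := mul_le_of_le_one_right hη (min_le_right _ _)
              have h3 := mul_le_mul_of_nonneg_left (hle (z - 1)) hθ.le
              rw [← abs_of_pos hθ, ← abs_mul, abs_of_pos hθ] at h3
              have h4 := abs_sub (r z) (θ * f (z - 1))
              calc |(1 + θ) * f z - θ * f (z - 1) + r z - (1 + θ) * f z|
                  = |r z - θ * f (z - 1)| := by congr 1; ring
                _ ≤ _ := by linarith)
          simp only [sub_zero, Real.rpow_zero, mul_one] at this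
          refine this.trans ?_
          gcongr
          · have : 0 < b := hy.trans_le hyb
            positivity
          · exact hM b
        refine ge_of_tendsto
          ((tendsto_const_mul_div_rpow_atTop M y (q := 1 + θ) (by linarith)).add_const _) ?_
          |>.trans (zero_add _).le
        filter_upwards [eventually_ge_atTop y] with b hyb using hb b hyb
    have h1 : S ≤ (η + θ * S) / (1 + θ) := ciSup_le step
    rw [le_div_iff₀ (by linarith)] at h1
    intro y
    have := hle y
    nlinarith
  -- On `(0, 1)` the delayed term vanishes and the error is at most `η y`; integrating from `1` with
  -- `s = 1` gives linear decay of `f` at `0`, so that the division by `a` is harmless.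
  have hsmall : a ≤ 1 → |f a| ≤ (1 + 1 / θ) * η * a := by
    intro ha1
    have := abs_le_of_abs_mul_deriv_sub_le (q := 1 + θ) (s := 1) (E := η)
      (by linarith) hη hf hf' ha ha1 (fun z hz hz1 => by
        have hz0 := ha.le.trans hz
        rw [hdelay z hz0, h0 (z - 1) (by linarith), Real.rpow_one]
        have h1 := hr z hz0
        rw [min_eq_left hz1.le] at h1
        calc |(1 + θ) * f z - θ * 0 + r z - (1 + θ) * f z| = |r z| := by congr 1; ring
          _ ≤ _ := h1)
    rw [div_one, Real.rpow_one, show 1 + θ - 1 = θ by ring] at this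
    have h2 : a ^ (1 + θ) ≤ a := by
      rw [Real.rpow_add ha, Real.rpow_one]
      exact mul_le_of_le_one_right ha.le (Real.rpow_le_one ha.le ha1 hθ.le)
    calc |f a| ≤ _ := this
      _ ≤ η * a + η / θ * a := by
        gcongr
        exact hsup 1
      _ = _ := by ring
  have hra := hr a ha.le
  have hd := hdelay a ha.le
  have htri : a * |f' a| ≤ (1 + θ) * |f a| + θ * |f (a - 1)| + |r a| := by
    have e1 : a * |f' a| = |a * f' a| := by rw [abs_mul, abs_of_pos ha]
    have e2 : (1 + θ) * |f a| = |(1 + θ) * f a| := by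
      rw [abs_mul, abs_of_pos (by linarith : 0 < 1 + θ)]
    have e3 : θ * |f (a - 1)| = |θ * f (a - 1)| := by rw [abs_mul, abs_of_pos hθ]
    rw [e1, e2, e3, hd]
    exact (abs_add_le _ _).trans (add_le_add_left (abs_sub _ _) _)
  rw [← mul_le_mul_iff_right₀ ha]
  refine htri.trans ?_
  have hθ1 : 0 < 1 / θ := by positivity
  rcases le_total a 1 with ha1 | ha1
  · rw [h0 (a - 1) (by linarith), abs_zero]
    rw [min_eq_left ha1] at hra
    have h1 := mul_le_mul_of_nonneg_left (hsmall ha1) (by linarith : 0 ≤ 1 + θ)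
    have e : (1 + θ) * ((1 + 1 / θ) * η * a) + η * a = a * ((3 + θ + 1 / θ) * η) := by
      field_simp
      ring
    have h5 : 0 ≤ a * (θ * η) := by positivity
    nlinarith
  · rw [min_eq_right ha1] at hra
    have h1 := hsup a
    have h2 := hsup (a - 1)
    have h3 : (2 + 2 * θ) * η ≤ a * ((3 + 2 * θ + 1 / θ) * η) := by
      have : (2 + 2 * θ) * η ≤ (3 + 2 * θ + 1 / θ) * η :=
        mul_le_mul_of_nonneg_right (by linarith) hη
      exact this.trans (le_mul_of_one_le_left (by positivity) ha1)
    nlinarith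

/-- The defect of `μ` in the equation that characterizes the Dickman law. -/
noncomputable def dickmanDefect (θ : ℝ) (μ : Measure ℝ) (a : ℝ) : ℝ :=
  a * cdf μ a - cdfInt μ a - θ * (cdfInt μ a - cdfInt μ (a - 1))

/-- The stability estimate for the difference of the two integrated distribution functions. The
bound `M` on the truncated expectations only makes this difference bounded; it does not enter the
conclusion. -/
lemma abs_cdf_sub_le_of_defect {θ M η : ℝ} (hθ : 0 < θ) {μ ν : Measure ℝ} [IsProbabilityMeasure μ]
    (hμ : μ (Iio 0) = 0) (hν : IsDickman θ ν) (hM : ∀ a, 0 ≤ a → a - cdfInt μ a ≤ M)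
    (hdef : ∀ a, 0 ≤ a → |dickmanDefect θ μ a| ≤ η * min a 1) {a : ℝ} (ha : 0 ≤ a) :
    |cdf μ a - cdf ν a| ≤ (3 + 2 * θ + 1 / θ) * η := by
  have := hν.isProbabilityMeasure
  have hη : 0 ≤ η := by
    have := (abs_nonneg _).trans (hdef 1 zero_le_one)
    simpa using this
  have hM0 : 0 ≤ M := by simpa [cdfInt_zero] using hM 0 le_rfl
  have hpos : ∀ a, 0 < a → |cdf μ a - cdf ν a| ≤ (3 + 2 * θ + 1 / θ) * η := by
    intro a ha
    refine abs_deriv_le_of_delay (f := fun y => cdfInt μ y - cdfInt ν y)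
      (f' := fun y => cdf μ y - cdf ν y) (r := dickmanDefect θ μ) (M := M + θ) hθ hη
      ((continuous_cdfInt μ).sub (continuous_cdfInt ν))
      (fun y => (hasDerivWithinAt_cdfInt μ y).sub (hasDerivWithinAt_cdfInt ν y))
      (fun y hy => by rw [cdfInt_of_nonpos hμ hy, cdfInt_of_nonpos hν.nonneg hy, sub_zero])
      (fun y => ?_) hdef (fun y hy => ?_) ha
    · rcases le_total y 0 with hy | hy
      · rw [cdfInt_of_nonpos hμ hy, cdfInt_of_nonpos hν.nonneg hy, sub_zero, abs_zero]
        positivity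
      · have h1 := cdfInt_le μ hy
        have h2 := cdfInt_le ν hy
        have h3 := hM y hy
        have h4 := sub_cdfInt_dickman_le hθ hν hy
        rw [abs_le]
        constructor <;> linarith
    · have h1 := cdfInt_dickman hθ hν hy
      simp only [dickmanDefect]
      linarith
  -- The stability estimate requires `a > 0`; the point `0` follows by right continuity.
  rcases ha.eq_or_lt with rfl | ha
  · have ht : Tendsto (fun y => |cdf μ y - cdf ν y|) (𝓝[>] 0) (𝓝 |cdf μ 0 - cdf ν 0|) :=
      ((((cdf μ).right_continuous 0).mono Ioi_subset_Ici_self).sub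
        (((cdf ν).right_continuous 0).mono Ioi_subset_Ici_self)).abs
    refine le_of_tendsto ht ?_
    filter_upwards [self_mem_nhdsWithin] with y hy using hpos y hy
  · exact hpos a ha

/-- The converse direction, for lower bounds: the defect is linear in the distribution function and
vanishes for the Dickman law, so it is controlled by the distance. -/
lemma abs_defect_le {θ d : ℝ} (hθ : 0 < θ) {μ ν : Measure ℝ} (hν : IsDickman θ ν)
    (hd : ∀ a, 0 ≤ a → |cdf μ a - cdf ν a| ≤ d) {a : ℝ} (ha : 1 ≤ a) :
    |dickmanDefect θ μ a| ≤ (2 + 2 * θ) * a * d := by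
  have := hν.isProbabilityMeasure
  have hd0 : 0 ≤ d := (abs_nonneg _).trans (hd 0 le_rfl)
  have hint : ∀ b, 0 ≤ b → |cdfInt μ b - cdfInt ν b| ≤ d * b := by
    intro b hb
    have e : cdfInt μ b - cdfInt ν b = ∫ y in (0 : ℝ)..b, (cdf μ y - cdf ν y) :=
      (intervalIntegral.integral_sub (intervalIntegrable_cdf μ _ _)
        (intervalIntegrable_cdf ν _ _)).symm
    have := intervalIntegral.norm_integral_le_of_norm_le_const (a := 0) (b := b) (C := d)
      (f := fun y => cdf μ y - cdf ν y) (fun y hy => by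
        rw [uIoc_of_le hb] at hy
        exact hd y hy.1.le)
    rw [e]
    rwa [sub_zero, abs_of_nonneg hb] at this
  have e : dickmanDefect θ μ a = a * (cdf μ a - cdf ν a) - (1 + θ) * (cdfInt μ a - cdfInt ν a)
      + θ * (cdfInt μ (a - 1) - cdfInt ν (a - 1)) := by
    have := cdfInt_dickman hθ hν (by linarith : 0 ≤ a)
    simp only [dickmanDefect]
    linarith
  have h1 := abs_le.1 (hd a (by linarith))
  have h2 := abs_le.1 (hint a (by linarith))
  have h3 := abs_le.1 (hint (a - 1) (by linarith))
  have ha0 : 0 ≤ a := by linarith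
  have hdθ : 0 ≤ d * θ := by positivity
  rw [e, abs_le]
  constructor <;>
  nlinarith [mul_le_mul_of_nonneg_left h1.1 ha0, mul_le_mul_of_nonneg_left h1.2 ha0,
    mul_le_mul_of_nonneg_left h2.1 (by linarith : 0 ≤ 1 + θ),
    mul_le_mul_of_nonneg_left h2.2 (by linarith : 0 ≤ 1 + θ),
    mul_le_mul_of_nonneg_left h3.1 hθ.le, mul_le_mul_of_nonneg_left h3.2 hθ.le]


/-! ### Weighted sums of independent Bernoulli variables -/

/-- `X k`, for `k ∈ s`, are independent and `X k` is `1` with probability `p k` and `0` otherwise. -/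
structure IsBernoulliArray {Ω : Type*} [MeasurableSpace Ω] (P : Measure Ω) (s : Finset ℕ)
    (p : ℕ → ℝ) (X : ℕ → Ω → ℝ) : Prop where
  aemeasurable : ∀ k ∈ s, AEMeasurable (X k) P
  zero_or_one : ∀ k ∈ s, ∀ᵐ ω ∂P, X k ω = 0 ∨ X k ω = 1
  integral : ∀ k ∈ s, ∫ ω, X k ω ∂P = p k
  zero : ∀ k ∈ s, P.real (X k ⁻¹' {0}) = 1 - p k
  indep : iIndepFun (fun k : s => X k) P

/-- The weighted sum `∑_{k ∈ s} k X_k`. -/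
def wsum {Ω : Type*} (X : ℕ → Ω → ℝ) (s : Finset ℕ) (ω : Ω) : ℝ := ∑ k ∈ s, (k : ℝ) * X k ω

/-- The law of `∑_{k ∈ s} k X_k`. -/
noncomputable def wsumLaw {Ω : Type*} [MeasurableSpace Ω] (P : Measure Ω) (X : ℕ → Ω → ℝ)
    (s : Finset ℕ) : Measure ℝ := P.map (wsum X s)

lemma wsum_erase {Ω : Type*} {s : Finset ℕ} (X : ℕ → Ω → ℝ) {k : ℕ} (hk : k ∈ s) (ω : Ω) :
    wsum X s ω = k * X k ω + wsum X (s.erase k) ω :=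
  (Finset.add_sum_erase s (fun k => (k : ℝ) * X k ω) hk).symm

section

variable {Ω : Type*} [MeasurableSpace Ω] {P : Measure Ω} {s : Finset ℕ} {p : ℕ → ℝ}
  {X : ℕ → Ω → ℝ}

lemma IsBernoulliArray.aemeasurable_wsum (h : IsBernoulliArray P s p X) {t : Finset ℕ}
    (ht : t ⊆ s) : AEMeasurable (wsum X t) P := by
  unfold wsum
  exact Finset.aemeasurable_fun_sum _ fun k hk => (h.aemeasurable k (ht hk)).const_mul _

lemma IsBernoulliArray.isProbabilityMeasure [IsProbabilityMeasure P] (h : IsBernoulliArray P s p X)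
    {t : Finset ℕ} (ht : t ⊆ s) : IsProbabilityMeasure (wsumLaw P X t) :=
  Measure.isProbabilityMeasure_map (h.aemeasurable_wsum ht)

lemma IsBernoulliArray.ae_natCast (h : IsBernoulliArray P s p X) {t : Finset ℕ} (ht : t ⊆ s) :
    ∀ᵐ x : ℝ ∂(wsumLaw P X t), ∃ m : ℕ, x = (m : ℝ) := by
  have hm : MeasurableSet {x : ℝ | ∃ m : ℕ, x = (m : ℝ)} := by
    have : {x : ℝ | ∃ m : ℕ, x = (m : ℝ)} = range (Nat.cast : ℕ → ℝ) := by
      ext x; simp [eq_comm]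
    rw [this]
    exact (countable_range _).measurableSet
  rw [wsumLaw, ae_map_iff (h.aemeasurable_wsum ht) hm]
  have hall : ∀ᵐ ω ∂P, ∀ k ∈ s, X k ω = 0 ∨ X k ω = 1 :=
    (ae_ball_iff s.countable_toSet).2 fun k hk => h.zero_or_one k hk
  filter_upwards [hall] with ω hω
  unfold wsum
  clear hm
  induction t using Finset.induction_on with
  | empty => exact ⟨0, by simp⟩
  | insert k t hkt ih =>
    obtain ⟨m, hm⟩ := ih ((Finset.subset_insert k t).trans ht)
    rw [Finset.sum_insert hkt, hm]
    rcases hω k (ht (Finset.mem_insert_self k t)) with h0 | h1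
    · exact ⟨m, by simp [h0]⟩
    · exact ⟨k + m, by simp [h1]⟩

lemma IsBernoulliArray.Iio_zero (h : IsBernoulliArray P s p X) {t : Finset ℕ} (ht : t ⊆ s) :
    wsumLaw P X t (Iio 0) = 0 := by
  have h1 : ∀ᵐ x : ℝ ∂(wsumLaw P X t), 0 ≤ x := by
    filter_upwards [h.ae_natCast ht] with x hx
    obtain ⟨m, rfl⟩ := hx
    exact m.cast_nonneg
  rw [ae_iff] at h1
  simpa [Iio] using h1

lemma IsBernoulliArray.indepFun (h : IsBernoulliArray P s p X) {k : ℕ} (hk : k ∈ s) :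
    IndepFun (X k) (wsum X (s.erase k)) P := by
  classical
  -- Rescaling every variable except the `k`-th by its index turns the weighted sum of the others
  -- into a plain sum of independent variables.
  have h1 := h.indep.comp (fun j x => if (j : ℕ) = k then x else (j : ℝ) * x) (fun j => by
    split_ifs
    · exact measurable_id
    · exact measurable_const_mul _)
  have h2 := (h1.indepFun_finsetSum_of_notMem₀ (s := Finset.univ.erase ⟨k, hk⟩) (i := ⟨k, hk⟩)
    (fun j => ?_) (by simp)).symm
  · convert h2 using 1
    · ext ω
      simp
    · ext ω
      have e : s.erase k = (Finset.univ.erase (⟨k, hk⟩ : s)).map (Function.Embedding.subtype _) := by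
        ext j
        simp only [Finset.mem_erase, Finset.mem_map, Finset.mem_univ, and_true,
          Function.Embedding.subtype_apply, Subtype.exists, ne_eq, Subtype.mk.injEq,
          exists_and_right, exists_eq_right, exists_prop]
        tauto
      rw [wsum, e, Finset.sum_map, Finset.sum_apply]
      refine Finset.sum_congr rfl fun j hj => ?_
      have : (j : ℕ) ≠ k := fun hjk => (Finset.mem_erase.1 hj).1 (Subtype.ext hjk)
      simp [this]
  · have := h.aemeasurable j j.2
    refine Measurable.comp_aemeasurable ?_ this
    split_ifs
    · exact measurable_id
    · exact measurable_const_mul _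

/-- Conditioning on the value of one variable. -/
lemma IsBernoulliArray.integral_mul_indicator [IsProbabilityMeasure P]
    (h : IsBernoulliArray P s p X) {k : ℕ} (hk : k ∈ s) {E : Set ℝ} (hE : MeasurableSet E) :
    ∫ ω, X k ω * E.indicator 1 (wsum X (s.erase k) ω) ∂P
      = p k * (wsumLaw P X (s.erase k)).real E := by
  have hS := h.aemeasurable_wsum (Finset.erase_subset k s)
  have hm : Measurable (E.indicator (1 : ℝ → ℝ)) := measurable_one.indicator hE
  have hi := (h.indepFun hk).comp measurable_id hm
  have := hi.integral_fun_mul_eq_mul_integral (h.aemeasurable k hk).aestronglyMeasurable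
    (hm.comp_aemeasurable hS).aestronglyMeasurable
  simp only [Function.comp_apply, id] at this
  rw [this, h.integral k hk, wsumLaw, ← integral_indicator_one hE,
    integral_map hS hm.aestronglyMeasurable]

lemma IsBernoulliArray.integrable_mul_indicator [IsProbabilityMeasure P]
    (h : IsBernoulliArray P s p X) {k : ℕ} (hk : k ∈ s) {t : Finset ℕ} (ht : t ⊆ s) {E : Set ℝ}
    (hE : MeasurableSet E) :
    Integrable (fun ω => X k ω * E.indicator 1 (wsum X t ω)) P := by
  have hm : Measurable (E.indicator (1 : ℝ → ℝ)) := measurable_one.indicator hE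
  refine Integrable.of_bound (C := 1) ((h.aemeasurable k hk).mul
    (hm.comp_aemeasurable (h.aemeasurable_wsum ht))).aestronglyMeasurable ?_
  filter_upwards [h.zero_or_one k hk] with ω hω
  rcases hω with h0 | h0 <;> by_cases hE : wsum X t ω ∈ E <;> simp [h0, hE]

/-- The size bias identity. -/
lemma IsBernoulliArray.setIntegral_id [IsProbabilityMeasure P] (h : IsBernoulliArray P s p X)
    {E : Set ℝ} (hE : MeasurableSet E) :
    ∫ x, x * E.indicator 1 x ∂(wsumLaw P X s)
      = ∑ k ∈ s, k * p k * (wsumLaw P X (s.erase k)).real ((fun x => x + k) ⁻¹' E) := by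
  have hS := h.aemeasurable_wsum subset_rfl
  have hm : Measurable (E.indicator (1 : ℝ → ℝ)) := measurable_one.indicator hE
  rw [wsumLaw, integral_map (f := fun x => x * E.indicator 1 x) hS
    (measurable_id.mul hm).aestronglyMeasurable]
  have e : ∀ ω, wsum X s ω * E.indicator 1 (wsum X s ω)
      = ∑ k ∈ s, k * (X k ω * E.indicator 1 (wsum X s ω)) := by
    intro ω
    conv_lhs => rw [wsum, Finset.sum_mul]
    simp only [mul_assoc]
    rfl
  simp only [e]
  rw [integral_finsetSum _ fun k hk =>
    (h.integrable_mul_indicator hk subset_rfl hE).const_mul _]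
  refine Finset.sum_congr rfl fun k hk => ?_
  rw [integral_const_mul, mul_assoc,
    ← h.integral_mul_indicator hk (E := (fun x => x + k) ⁻¹' E) (measurable_add_const _ hE)]
  congr 1
  -- Only the event `X k = 1` contributes, and there the full sum is `k` plus the sum without `X k`.
  refine integral_congr_ae ?_
  filter_upwards [h.zero_or_one k hk] with ω hω
  rcases hω with h0 | h0
  · simp [h0]
  · rw [wsum_erase X hk, h0, mul_one, add_comm]
    rfl

/-- The decomposition according to the value of one variable. -/
lemma IsBernoulliArray.real_eq [IsProbabilityMeasure P] (h : IsBernoulliArray P s p X) {k : ℕ}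
    (hk : k ∈ s) {E : Set ℝ} (hE : MeasurableSet E) :
    (wsumLaw P X s).real E = (1 - p k) * (wsumLaw P X (s.erase k)).real E
      + p k * (wsumLaw P X (s.erase k)).real ((fun x => x + k) ⁻¹' E) := by
  have hS := h.aemeasurable_wsum subset_rfl
  have hS' := h.aemeasurable_wsum (Finset.erase_subset k s)
  have hE' : MeasurableSet ((fun x : ℝ => x + k) ⁻¹' E) := measurable_add_const _ hE
  have hm : Measurable (E.indicator (1 : ℝ → ℝ)) := measurable_one.indicator hE
  have e1 : (wsumLaw P X s).real E = ∫ ω, E.indicator (1 : ℝ → ℝ) (wsum X s ω) ∂P := by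
    rw [wsumLaw, ← integral_indicator_one hE, integral_map hS hm.aestronglyMeasurable]
  have e2 : (wsumLaw P X (s.erase k)).real E
      = ∫ ω, E.indicator (1 : ℝ → ℝ) (wsum X (s.erase k) ω) ∂P := by
    rw [wsumLaw, ← integral_indicator_one hE, integral_map hS' hm.aestronglyMeasurable]
  rw [sub_mul, one_mul, ← h.integral_mul_indicator hk hE, ← h.integral_mul_indicator hk hE', e1, e2,
    ← integral_sub _ (h.integrable_mul_indicator hk (Finset.erase_subset k s) hE),
    ← integral_add _ (h.integrable_mul_indicator hk (Finset.erase_subset k s) hE')]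
  · refine integral_congr_ae ?_
    filter_upwards [h.zero_or_one k hk] with ω hω
    rcases hω with h0 | h0
    · rw [wsum_erase X hk, h0]
      simp
    · rw [wsum_erase X hk, h0, mul_one, add_comm, one_mul, one_mul, sub_self, zero_add]
      rfl
  · refine Integrable.sub ?_ (h.integrable_mul_indicator hk (Finset.erase_subset k s) hE)
    refine Integrable.of_bound (C := 1) (hm.comp_aemeasurable hS').aestronglyMeasurable
      (Eventually.of_forall fun ω => ?_)
    by_cases hE : wsum X (s.erase k) ω ∈ E <;> simp [hE]
  · refine Integrable.of_bound (C := 1) (hm.comp_aemeasurable hS').aestronglyMeasurable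
      (Eventually.of_forall fun ω => ?_)
    by_cases hE : wsum X (s.erase k) ω ∈ E <;> simp [hE]

/-- The sum can be at most `x` only if all variables with larger index vanish. -/
lemma IsBernoulliArray.real_Iic_le [IsProbabilityMeasure P] (h : IsBernoulliArray P s p X)
    {t u : Finset ℕ} (ht : t ⊆ s) (hu : u ⊆ t) {x : ℝ} (hx : ∀ k ∈ u, x < k) :
    (wsumLaw P X t).real (Iic x) ≤ ∏ k ∈ u, (1 - p k) := by
  classical
  have hall : ∀ᵐ ω ∂P, ∀ k ∈ s, X k ω = 0 ∨ X k ω = 1 :=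
    (ae_ball_iff s.countable_toSet).2 fun k hk => h.zero_or_one k hk
  have hprod : P.real (⋂ k ∈ u.subtype (· ∈ s), X k ⁻¹' {0}) = ∏ k ∈ u, (1 - p k) := by
    have := h.indep.measure_inter_preimage_eq_mul (u.subtype (· ∈ s))
      (sets := fun _ => {0}) (fun _ _ => measurableSet_singleton 0)
    rw [measureReal_def, this, ENNReal.toReal_prod, Finset.prod_subtype_of_mem
      (fun k => (P (X k ⁻¹' {0})).toReal) (fun k hk => ht (hu hk))]
    exact Finset.prod_congr rfl fun k hk => h.zero k (ht (hu hk))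
  rw [← hprod, wsumLaw, measureReal_def, measureReal_def,
    Measure.map_apply_of_aemeasurable (h.aemeasurable_wsum ht) measurableSet_Iic]
  refine ENNReal.toReal_mono (measure_ne_top _ _) (measure_mono_ae ?_)
  filter_upwards [hall] with ω hω hle
  refine mem_iInter₂.2 fun k hk => ?_
  have hku : (k : ℕ) ∈ u := Finset.mem_subtype.1 hk
  refine (hω k k.2).resolve_right fun h1 => ?_
  have h2 : (k : ℝ) * X k ω ≤ wsum X t ω := by
    refine Finset.single_le_sum (f := fun k : ℕ => (k : ℝ) * X k ω) (fun j hj => ?_) (hu hku)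
    rcases hω j (ht hj) with h0 | h0 <;> simp [h0]
  rw [h1, mul_one] at h2
  exact absurd (h2.trans hle) (not_le.2 (hx k hku))

end

/-- A Bernoulli family as in the statement is a Bernoulli array. -/
lemma isBernoulliArray_of_family {θ β : ℝ} {hθ : 0 < θ} {l n : ℕ} {hl : θ - β ≤ l}
    {Ω : Type u} [MeasurableSpace Ω] {P : Measure Ω} [IsProbabilityMeasure P] {B : ℕ → Ω → ℝ}
    (h : IsBernoulliFamily hθ hl n P B) :
    IsBernoulliArray P (Finset.Icc l n) (fun k => θ / (k + β)) B where
  aemeasurable k hk := (h.hasLaw k (Finset.mem_Icc.1 hk).1 (Finset.mem_Icc.1 hk).2).aemeasurable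
  zero_or_one k hk := by
    have h1 := h.hasLaw k (Finset.mem_Icc.1 hk).1 (Finset.mem_Icc.1 hk).2
    have hm : MeasurableSet {x : ℝ | x = 0 ∨ x = 1} :=
      (measurableSet_singleton 0).union (measurableSet_singleton 1)
    rw [← ae_map_iff (p := fun x => x = 0 ∨ x = 1) h1.aemeasurable hm, h1.map_eq, ae_iff]
    have hm' : MeasurableSet {x : ℝ | ¬(x = 0 ∨ x = 1)} := hm.compl
    exact bernoulliMeasure_apply_of_notMem_of_notMem _ hm' (by simp) (by simp)
  integral k hk := by
    have h1 := h.hasLaw k (Finset.mem_Icc.1 hk).1 (Finset.mem_Icc.1 hk).2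
    have h2 := integral_map h1.aemeasurable (f := fun x : ℝ => x) (by fun_prop)
    rw [← h2, h1.map_eq, integral_bernoulliMeasure]
    simp
  zero k hk := by
    have h1 := h.hasLaw k (Finset.mem_Icc.1 hk).1 (Finset.mem_Icc.1 hk).2
    rw [measureReal_def, ← Measure.map_apply_of_aemeasurable h1.aemeasurable
      (measurableSet_singleton 0), ← measureReal_def, h1.map_eq,
      bernoulliMeasure_real_apply_of_notMem_of_mem _ (measurableSet_singleton 0) (by simp) (by simp)]
  indep := h.indep


/-! ### Harmonic sums -/

lemma log_div_le_sum_inv {b : ℝ} (hb : 0 ≤ b) {m n : ℕ} (hmn : m ≤ n) :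
    Real.log ((n + 1 + b) / (m + 1 + b)) ≤ ∑ k ∈ Finset.Icc (m + 1) n, 1 / ((k : ℝ) + b) := by
  induction n, hmn using Nat.le_induction with
  | base =>
    have : (m : ℝ) + 1 + b ≠ 0 := by positivity
    simp [div_self this]
  | succ n hmn ih =>
    rw [← Finset.insert_Icc_right_eq_Icc_add_one (by omega), Finset.sum_insert (by simp)]
    have h1 : (0 : ℝ) < n + 1 + b := by positivity
    have h2 : (0 : ℝ) < m + 1 + b := by positivity
    have h3 : ((↑(n + 1) + 1 + b) / (m + 1 + b) : ℝ)
        = (1 + 1 / (↑(n + 1) + b)) * ((n + 1 + b) / (m + 1 + b)) := by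
      push_cast
      field_simp
      ring
    have h4 : (0 : ℝ) < 1 + 1 / (↑(n + 1) + b) := by positivity
    rw [h3, Real.log_mul h4.ne' (by positivity)]
    have := Real.log_le_sub_one_of_pos h4
    linarith

lemma sum_inv_le_log {l n : ℕ} (hl : 1 ≤ l) (hln : l ≤ n) :
    ∑ k ∈ Finset.Icc l n, 1 / (k : ℝ) ≤ 1 + Real.log (n / l) := by
  have hl0 : (0 : ℝ) < l := by exact_mod_cast hl
  induction n, hln using Nat.le_induction with
  | base =>
    have : (1 : ℝ) ≤ l := by exact_mod_cast hl
    simp only [Finset.Icc_self, Finset.sum_singleton, div_self hl0.ne', Real.log_one, add_zero]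
    exact (div_le_one hl0).2 this
  | succ n hln ih =>
    rw [← Finset.insert_Icc_right_eq_Icc_add_one (by omega), Finset.sum_insert (by simp)]
    have hn0 : (0 : ℝ) < n := hl0.trans_le (by exact_mod_cast hln)
    have hn1 : (0 : ℝ) < (↑(n + 1) : ℝ) := by positivity
    have h1 := Real.one_sub_inv_le_log_of_pos (x := (↑(n + 1) / n : ℝ)) (by positivity)
    have h2 : (↑(n + 1) / l : ℝ) = (↑(n + 1) / n) * (n / l) := by field_simp
    rw [h2, Real.log_mul (by positivity) (by positivity)]
    have h3 : 1 - (↑(n + 1) / n : ℝ)⁻¹ = 1 / ↑(n + 1) := by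
      field_simp
      push_cast
      ring
    linarith

/-! ### The success probabilities -/

/-- The success probability of the `k`-th variable. -/
noncomputable def successProb (θ β : ℝ) (k : ℕ) : ℝ := θ / (k + β)

section

variable {θ β : ℝ} {l k : ℕ}

lemma le_add_of_le (hl : θ - β ≤ l) (hk : l ≤ k) : θ ≤ k + β := by
  have : (l : ℝ) ≤ k := Nat.cast_le.2 hk
  linarith

/-- Since `k + β ≥ θ`, the shift satisfies `|β| ≤ (|β| / θ) (k + β)`. This makes all comparisons
with `1 / k` uniform in `l`, also for negative `β`. -/
lemma inv_add_le (hθ : 0 < θ) (hl : θ - β ≤ l) (hl1 : 1 ≤ l) (hk : l ≤ k) :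
    1 / (k + β) ≤ (1 + |β| / θ) * (1 / k) := by
  have h1 := le_add_of_le hl hk
  have hk0 : (0 : ℝ) < k := by exact_mod_cast (hl1.trans hk)
  have hpos : 0 < k + β := hθ.trans_le h1
  rw [mul_one_div, div_le_div_iff₀ hpos hk0, one_mul]
  have h2 : |β| ≤ |β| / θ * (k + β) := by
    rw [div_mul_eq_mul_div, le_div_iff₀ hθ]
    gcongr
  nlinarith [neg_abs_le β]

lemma successProb_nonneg (hθ : 0 < θ) (hl : θ - β ≤ l) (hk : l ≤ k) : 0 ≤ successProb θ β k :=
  (div_add_mem_unitInterval hθ hl hk).1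

lemma successProb_le_one (hθ : 0 < θ) (hl : θ - β ≤ l) (hk : l ≤ k) : successProb θ β k ≤ 1 :=
  (div_add_mem_unitInterval hθ hl hk).2

lemma mul_successProb (hθ : 0 < θ) (hl : θ - β ≤ l) (hk : l ≤ k) :
    k * successProb θ β k = θ - θ * β * (1 / (k + β)) := by
  have : (k : ℝ) + β ≠ 0 := (hθ.trans_le (le_add_of_le hl hk)).ne'
  unfold successProb
  field_simp
  ring

lemma mul_successProb_le (hθ : 0 < θ) (hl : θ - β ≤ l) (hl1 : 1 ≤ l) (hk : l ≤ k) :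
    k * successProb θ β k ≤ θ + |β| := by
  have hk0 : (0 : ℝ) < k := by exact_mod_cast (hl1.trans hk)
  have h1 := inv_add_le hθ hl hl1 hk
  calc k * successProb θ β k = k * θ * (1 / (k + β)) := by unfold successProb; ring
    _ ≤ k * θ * ((1 + |β| / θ) * (1 / k)) := by gcongr
    _ = θ + |β| := by field_simp

/-- The indices whose success probability exceeds `1 / 2`. -/
noncomputable def largeProbIndices (θ β : ℝ) (s : Finset ℕ) : Finset ℕ :=
  s.filter fun k => k + β < 2 * θ

/-- Such an index is below `2θ - β`. The bound depends neither on `l` nor on `n`, so these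
exceptional indices can be estimated one by one. -/
lemma card_largeProbIndices_le (θ β : ℝ) (s : Finset ℕ) :
    (largeProbIndices θ β s).card ≤ ⌈2 * θ + |β|⌉₊ := by
  rw [← Finset.card_range ⌈2 * θ + |β|⌉₊]
  refine Finset.card_le_card fun k hk => ?_
  rw [Finset.mem_range, Nat.lt_ceil]
  have := (Finset.mem_filter.1 hk).2
  linarith [neg_abs_le β]

lemma successProb_le_half (hθ : 0 < θ) (hl : θ - β ≤ l) (hk : l ≤ k) (h : 2 * θ ≤ k + β) :
    successProb θ β k ≤ 1 / 2 := by
  have : 0 < k + β := hθ.trans_le (le_add_of_le hl hk)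
  unfold successProb
  rw [div_le_div_iff₀ this two_pos]
  linarith

end

/-! ### Lower tail and concentration -/

/-- The constant in the lower tail bound. -/
noncomputable def tailConst (θ β : ℝ) : ℝ := Real.exp 1 * (2 + |β|) ^ θ

lemma one_le_tailConst {θ : ℝ} (β : ℝ) (hθ : 0 < θ) : 1 ≤ tailConst θ β := by
  unfold tailConst
  have h1 : 1 ≤ Real.exp 1 := Real.one_le_exp zero_le_one
  have h2 : 1 ≤ (2 + |β|) ^ θ := Real.one_le_rpow (by linarith [abs_nonneg β]) hθ.le
  nlinarith

section

variable {θ β : ℝ} {l n : ℕ} {Ω : Type*} [MeasurableSpace Ω] {P : Measure Ω}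
  [IsProbabilityMeasure P] {X : ℕ → Ω → ℝ}

/-- A sum at most `x` forces all variables with index above `x` to vanish; this has probability at
most `exp (-∑ p_k)`, and the sum of `θ / (k + β)` over `x < k ≤ n` is about `θ log (n / x)`. -/
lemma real_Iic_erase_le_of_le (hθ : 0 < θ) (hl : θ - β ≤ l) (hl1 : 1 ≤ l) (hln : l ≤ n)
    (h : IsBernoulliArray P (Finset.Icc l n) (successProb θ β) X) (j : ℕ) {x : ℝ} (hx : l ≤ x) :
    (wsumLaw P X ((Finset.Icc l n).erase j)).real (Iic x)
      ≤ tailConst θ β * (min x n / n) ^ θ := by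
  have hn0 : (0 : ℝ) < n := by exact_mod_cast hl1.trans hln
  have := h.isProbabilityMeasure (Finset.erase_subset j _)
  have hl0 : (0 : ℝ) < l := by exact_mod_cast hl1
  rcases le_or_gt (n : ℝ) x with hxn | hxn
  · rw [min_eq_right hxn, div_self hn0.ne', Real.one_rpow, mul_one]
    exact measureReal_le_one.trans (one_le_tailConst β hθ)
  rw [min_eq_left hxn.le]
  have hx0 : 0 ≤ x := hl0.le.trans hx
  set m := ⌊x⌋₊ with hm
  have hmx : (m : ℝ) ≤ x := Nat.floor_le hx0
  have hlm : l ≤ m := Nat.le_floor hx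
  have hmn : m < n := by exact_mod_cast hmx.trans_lt hxn
  have hm1 : (1 : ℝ) ≤ m := by exact_mod_cast hl1.trans hlm
  have hsub : Finset.Icc (m + 1) n ⊆ Finset.Icc l n := Finset.Icc_subset_Icc (by omega) le_rfl
  have hk : ∀ k ∈ Finset.Icc (m + 1) n, l ≤ k := fun k hk => (Finset.mem_Icc.1 (hsub hk)).1
  have hb := abs_nonneg β
  have step1 := h.real_Iic_le (Finset.erase_subset j _)
    (Finset.erase_subset_erase j hsub) (x := x) (fun k hk' => by
      have := (Finset.mem_Icc.1 (Finset.mem_of_mem_erase hk')).1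
      have h2 := Nat.lt_floor_add_one x
      have h3 : ((m + 1 : ℕ) : ℝ) ≤ k := by exact_mod_cast this
      push_cast at h3
      linarith)
  have step2 : ∏ k ∈ (Finset.Icc (m + 1) n).erase j, (1 - successProb θ β k)
      ≤ Real.exp (-∑ k ∈ (Finset.Icc (m + 1) n).erase j, successProb θ β k) := by
    rw [← Finset.sum_neg_distrib, Real.exp_sum]
    refine Finset.prod_le_prod (fun k hk' => ?_) fun k hk' => ?_
    · have := successProb_le_one hθ hl (hk k (Finset.mem_of_mem_erase hk'))
      linarith
    · linarith [Real.add_one_le_exp (-successProb θ β k)]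
  -- The omitted index costs at most `1` in the exponent, whence the factor `exp 1` in `tailConst`.
  have step3 : ∑ k ∈ Finset.Icc (m + 1) n, successProb θ β k - 1
      ≤ ∑ k ∈ (Finset.Icc (m + 1) n).erase j, successProb θ β k := by
    by_cases hj : j ∈ Finset.Icc (m + 1) n
    · rw [← Finset.add_sum_erase _ _ hj]
      have := successProb_le_one hθ hl (hk j hj)
      linarith
    · rw [Finset.erase_eq_of_notMem hj]
      linarith
  have step4 : θ * Real.log ((n + 1 + |β|) / (m + 1 + |β|))
      ≤ ∑ k ∈ Finset.Icc (m + 1) n, successProb θ β k := by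
    refine (mul_le_mul_of_nonneg_left (log_div_le_sum_inv hb hmn.le) hθ.le).trans ?_
    rw [Finset.mul_sum]
    refine Finset.sum_le_sum fun k hk' => ?_
    have := hθ.trans_le (le_add_of_le hl (hk k hk'))
    rw [mul_one_div, successProb]
    gcongr
    exact le_abs_self β
  refine step1.trans (step2.trans ?_)
  have hpos1 : (0 : ℝ) < n + 1 + |β| := by positivity
  have hpos2 : (0 : ℝ) < m + 1 + |β| := by positivity
  calc Real.exp (-∑ k ∈ (Finset.Icc (m + 1) n).erase j, successProb θ β k)
      ≤ Real.exp (1 + Real.log ((m + 1 + |β|) / (n + 1 + |β|)) * θ) := by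
        refine Real.exp_le_exp.2 ?_
        have : Real.log ((m + 1 + |β|) / (n + 1 + |β|))
            = -Real.log ((n + 1 + |β|) / (m + 1 + |β|)) := by
          rw [← Real.log_inv, inv_div]
        rw [this]
        linarith
    _ = Real.exp 1 * ((m + 1 + |β|) / (n + 1 + |β|)) ^ θ := by
        rw [Real.exp_add, Real.rpow_def_of_pos (by positivity)]
    -- Here `m ≤ x` and `x ≥ l ≥ 1` give `m + 1 + |β| ≤ (2 + |β|) x`.
    _ ≤ Real.exp 1 * ((2 + |β|) * (x / n)) ^ θ := by
        gcongr
        rw [← mul_div_assoc]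
        gcongr
        · nlinarith
        · linarith
    _ = tailConst θ β * (x / n) ^ θ := by
        rw [Real.mul_rpow (by positivity) (by positivity), tailConst, mul_assoc]

lemma erase_zero_Icc (hl1 : 1 ≤ l) : (Finset.Icc l n).erase 0 = Finset.Icc l n :=
  Finset.erase_eq_of_notMem fun h => by
    have := (Finset.mem_Icc.1 h).1
    omega

lemma real_Iic_le_of_le (hθ : 0 < θ) (hl : θ - β ≤ l) (hl1 : 1 ≤ l) (hln : l ≤ n)
    (h : IsBernoulliArray P (Finset.Icc l n) (successProb θ β) X) {x : ℝ} (hx : l ≤ x) :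
    (wsumLaw P X (Finset.Icc l n)).real (Iic x) ≤ tailConst θ β * (min x n / n) ^ θ := by
  have := real_Iic_erase_le_of_le hθ hl hl1 hln h 0 hx
  rwa [erase_zero_Icc hl1] at this

/-- For `θ ≥ 1` the lower tail is at most linear. -/
lemma real_Iic_erase_le_linear (hθ1 : 1 ≤ θ) (hl : θ - β ≤ l) (hl1 : 1 ≤ l) (hln : l ≤ n)
    (h : IsBernoulliArray P (Finset.Icc l n) (successProb θ β) X) (j : ℕ) {x : ℝ} (hx : l ≤ x) :
    (wsumLaw P X ((Finset.Icc l n).erase j)).real (Iic x) ≤ tailConst θ β * (min x n / n) := by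
  have hn0 : (0 : ℝ) < n := by exact_mod_cast hl1.trans hln
  have hl0 : (0 : ℝ) < l := by exact_mod_cast hl1
  have hθ : 0 < θ := one_pos.trans_le hθ1
  have hz : 0 ≤ min x n := le_min (hl0.le.trans hx) hn0.le
  have hC := one_le_tailConst β hθ
  refine (real_Iic_erase_le_of_le hθ hl hl1 hln h j hx).trans ?_
  gcongr
  exact Real.rpow_le_self_of_le_one (by positivity) ((div_le_one hn0).2 (min_le_right _ _)) hθ1

lemma real_Iic_le_linear (hθ1 : 1 ≤ θ) (hl : θ - β ≤ l) (hl1 : 1 ≤ l) (hln : l ≤ n)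
    (h : IsBernoulliArray P (Finset.Icc l n) (successProb θ β) X) {x : ℝ} (hx : l ≤ x) :
    (wsumLaw P X (Finset.Icc l n)).real (Iic x) ≤ tailConst θ β * (min x n / n) := by
  have := real_Iic_erase_le_linear hθ1 hl hl1 hln h 0 hx
  rwa [erase_zero_Icc hl1] at this

/-- Removing a variable with success probability at most `1 / 2` at most doubles probabilities. -/
lemma real_erase_le_two_mul (hθ : 0 < θ) (hl : θ - β ≤ l)
    (h : IsBernoulliArray P (Finset.Icc l n) (successProb θ β) X) {k : ℕ}
    (hk : k ∈ Finset.Icc l n) (hk2 : 2 * θ ≤ k + β) {E : Set ℝ} (hE : MeasurableSet E) :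
    (wsumLaw P X ((Finset.Icc l n).erase k)).real E ≤ 2 * (wsumLaw P X (Finset.Icc l n)).real E := by
  have hlk := (Finset.mem_Icc.1 hk).1
  have h1 := successProb_le_half hθ hl hlk hk2
  have h2 := successProb_nonneg hθ hl hlk
  rw [h.real_eq hk hE]
  have h3 : 0 ≤ (wsumLaw P X ((Finset.Icc l n).erase k)).real E := measureReal_nonneg
  have h4 : 0 ≤ (wsumLaw P X ((Finset.Icc l n).erase k)).real ((fun x => x + k) ⁻¹' E) :=
    measureReal_nonneg
  nlinarith [mul_nonneg h2 h4]

lemma sum_real_singleton_sub_le {μ : Measure ℝ} [IsFiniteMeasure μ] (s : Finset ℕ) (m : ℝ) :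
    ∑ k ∈ s, μ.real {m - k} ≤ μ.real (Iic m) := by
  rw [← measureReal_biUnion_finset]
  · refine measureReal_mono (iUnion₂_subset fun k _ => ?_)
    rintro _ rfl
    exact sub_le_self m k.cast_nonneg
  · intro i _ j _ hij
    simp [Function.onFun, hij]
  · exact fun k _ => measurableSet_singleton _

/-- The constant in the concentration bound. -/
noncomputable def atomConst (θ β : ℝ) : ℝ :=
  tailConst θ β * ((θ + |β|) * (2 + ⌈2 * θ + |β|⌉₊) + 1)

/-- Size biasing gives `m P(S = m) = ∑ k p_k P(S_k = m - k)` with `S_k` the sum without the `k`-th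
variable. The weights are bounded and, up to a factor `2` and boundedly many indices, `S_k` may be
replaced by `S`; the remaining sum is at most `P(S ≤ m)`, which is `O(m l / n)`. Dividing by `m`
leaves `O(l / n)`. -/
lemma real_singleton_natCast_le (hθ1 : 1 ≤ θ) (hl : θ - β ≤ l) (hl1 : 1 ≤ l) (hln : l ≤ n)
    (h : IsBernoulliArray P (Finset.Icc l n) (successProb θ β) X) (m : ℕ) :
    (wsumLaw P X (Finset.Icc l n)).real {(m : ℝ)} ≤ atomConst θ β * (l / n) := by
  have hn0 : (0 : ℝ) < n := by exact_mod_cast hl1.trans hln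
  have hl0 : (0 : ℝ) < l := by exact_mod_cast hl1
  have hl1' : (1 : ℝ) ≤ l := by exact_mod_cast hl1
  have hθ : 0 < θ := one_pos.trans_le hθ1
  have hC := one_le_tailConst β hθ
  have hb := abs_nonneg β
  have hprob := h.isProbabilityMeasure subset_rfl
  have hprob' : ∀ j, IsProbabilityMeasure (wsumLaw P X ((Finset.Icc l n).erase j)) := fun j =>
    h.isProbabilityMeasure (Finset.erase_subset j _)
  set s := Finset.Icc l n with hs
  -- At `m = 0` the size bias identity is empty, and the lower tail at `l` is used instead.
  rcases Nat.eq_zero_or_pos m with rfl | hm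
  · calc (wsumLaw P X s).real {((0 : ℕ) : ℝ)} ≤ (wsumLaw P X s).real (Iic (l : ℝ)) := by
          refine measureReal_mono ?_
          rintro _ rfl
          simp
      _ ≤ tailConst θ β * (min (l : ℝ) n / n) := real_Iic_le_linear hθ1 hl hl1 hln h le_rfl
      _ ≤ tailConst θ β * (l / n) := by gcongr; exact min_le_left _ _
      _ ≤ atomConst θ β * (l / n) := by
        unfold atomConst
        gcongr
        exact le_mul_of_one_le_right (by linarith) (le_add_of_nonneg_left (by positivity))
  · have hm1 : (1 : ℝ) ≤ m := by exact_mod_cast hm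
    -- The tail bound needs an argument at least `l`; enlarging `m` to `m * l` guarantees this for
    -- every `m ≥ 1`.
    set τ := tailConst θ β * (m * l / n) with hτ
    have htail : ∀ j, (wsumLaw P X (s.erase j)).real (Iic (m : ℝ)) ≤ τ := by
      intro j
      calc (wsumLaw P X (s.erase j)).real (Iic (m : ℝ))
          ≤ (wsumLaw P X (s.erase j)).real (Iic (m * l : ℝ)) :=
            measureReal_mono (Iic_subset_Iic.2 (le_mul_of_one_le_right (by linarith) hl1'))
        _ ≤ tailConst θ β * (min (m * l : ℝ) n / n) :=
            real_Iic_erase_le_linear hθ1 hl hl1 hln h j (le_mul_of_one_le_left hl0.le hm1)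
        _ ≤ τ := by rw [hτ]; gcongr; exact min_le_left _ _
    have htail0 : (wsumLaw P X s).real (Iic (m : ℝ)) ≤ τ := by
      have := htail 0
      rwa [hs, erase_zero_Icc hl1] at this
    have hτ0 : 0 ≤ τ := measureReal_nonneg.trans htail0
    have hbias : m * (wsumLaw P X s).real {(m : ℝ)}
        = ∑ k ∈ s, k * successProb θ β k * (wsumLaw P X (s.erase k)).real {(m : ℝ) - k} := by
      have h1 := h.setIntegral_id (measurableSet_singleton (m : ℝ))
      have h2 : ∀ x : ℝ, x * ({(m : ℝ)} : Set ℝ).indicator 1 x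
          = m * ({(m : ℝ)} : Set ℝ).indicator 1 x := by
        intro x
        by_cases hx : x = m
        · rw [hx]
        · simp [hx]
      simp only [h2] at h1
      rw [integral_const_mul, integral_indicator_one (measurableSet_singleton _)] at h1
      rw [h1]
      refine Finset.sum_congr rfl fun k _ => ?_
      congr 2
      ext x
      exact eq_sub_iff_add_eq.symm
    have hterm : ∀ k ∈ s, k * successProb θ β k * (wsumLaw P X (s.erase k)).real {(m : ℝ) - k}
        ≤ (θ + |β|) * (2 * (wsumLaw P X s).real {(m : ℝ) - k}
          + if k ∈ largeProbIndices θ β s then τ else 0) := by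
      intro k hk
      have hlk := (Finset.mem_Icc.1 hk).1
      refine mul_le_mul (mul_successProb_le hθ hl hl1 hlk) ?_ measureReal_nonneg (by positivity)
      split_ifs with hbad
      · have h1 : (wsumLaw P X (s.erase k)).real {(m : ℝ) - k} ≤ τ := by
          refine (measureReal_mono ?_).trans (htail k)
          rintro _ rfl
          exact sub_le_self (m : ℝ) (Nat.cast_nonneg (α := ℝ) k)
        have h2 : 0 ≤ (wsumLaw P X s).real {(m : ℝ) - k} := measureReal_nonneg
        linarith
      · rw [add_zero]
        refine real_erase_le_two_mul hθ hl h hk ?_ (measurableSet_singleton _)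
        by_contra hcon
        exact hbad (Finset.mem_filter.2 ⟨hk, not_le.1 hcon⟩)
    have hsum : m * (wsumLaw P X s).real {(m : ℝ)}
        ≤ (θ + |β|) * (2 * τ + ⌈2 * θ + |β|⌉₊ * τ) := by
      rw [hbias]
      refine (Finset.sum_le_sum hterm).trans ?_
      rw [← Finset.mul_sum, Finset.sum_add_distrib, ← Finset.mul_sum, ← Finset.sum_filter,
        Finset.sum_const, nsmul_eq_mul]
      have h1 := sum_real_singleton_sub_le (μ := wsumLaw P X s) s m
      have h2 : (((s.filter fun k => k ∈ largeProbIndices θ β s).card : ℕ) : ℝ)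
          ≤ ⌈2 * θ + |β|⌉₊ := by
        have h3 : (s.filter fun k => k ∈ largeProbIndices θ β s) ⊆ largeProbIndices θ β s :=
          fun k hk => (Finset.mem_filter.1 hk).2
        exact_mod_cast (Finset.card_le_card h3).trans (card_largeProbIndices_le θ β s)
      gcongr
      exact h1.trans htail0
    rw [← mul_le_mul_iff_right₀ (by linarith : (0 : ℝ) < m)]
    refine hsum.trans ?_
    calc (θ + |β|) * (2 * τ + ⌈2 * θ + |β|⌉₊ * τ)
        = ((θ + |β|) * (2 + ⌈2 * θ + |β|⌉₊)) * τ := by ring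
      _ ≤ ((θ + |β|) * (2 + ⌈2 * θ + |β|⌉₊) + 1) * τ := by gcongr; linarith
      _ = m * (atomConst θ β * (l / n)) := by rw [hτ, atomConst]; ring

/-- A half-open interval of length `k` contains exactly `k` integers, and the negative ones carry no
mass. -/
lemma real_Ioc_le_of_singleton {μ : Measure ℝ} [IsFiniteMeasure μ]
    (hμ : ∀ᵐ x : ℝ ∂μ, ∃ m : ℕ, x = (m : ℝ)) {c : ℝ} (hc : ∀ m : ℕ, μ.real {(m : ℝ)} ≤ c)
    (y : ℝ) (k : ℕ) : μ.real (Ioc (y - k) y) ≤ k * c := by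
  have hc0 : 0 ≤ c := measureReal_nonneg.trans (hc 0)
  have hz : ∀ z : ℤ, μ.real {(z : ℝ)} ≤ c := by
    intro z
    rcases le_or_gt 0 z with hz | hz
    · lift z to ℕ using hz
      exact_mod_cast hc z
    · have : μ {(z : ℝ)} = 0 := by
        refine measure_mono_null (fun x hx => ?_) (ae_iff.1 hμ)
        rintro ⟨m, hm⟩
        rw [mem_singleton_iff.1 hx] at hm
        have : z = m := by exact_mod_cast hm
        omega
      rw [measureReal_def, this]
      exact hc0
  calc μ.real (Ioc (y - k) y)
      ≤ μ.real (⋃ z ∈ Finset.Ioc (⌊y⌋ - k) ⌊y⌋, {(z : ℝ)}) := by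
        refine ENNReal.toReal_mono (measure_ne_top _ _) (measure_mono_ae ?_)
        filter_upwards [hμ] with x hx hxy
        obtain ⟨m, rfl⟩ := hx
        refine mem_iUnion₂.2 ⟨(m : ℤ), ?_, by simp⟩
        rw [Finset.mem_Ioc]
        constructor
        · have h1 : y - k < m := hxy.1
          have h2 : ⌊y - k⌋ < (m : ℤ) := Int.floor_lt.2 (by exact_mod_cast h1)
          rwa [Int.floor_sub_natCast] at h2
        · exact Int.le_floor.2 (by exact_mod_cast hxy.2)
    _ ≤ ∑ z ∈ Finset.Ioc (⌊y⌋ - k) ⌊y⌋, μ.real {(z : ℝ)} := measureReal_biUnion_finset_le _ _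
    _ ≤ ∑ z ∈ Finset.Ioc (⌊y⌋ - k) ⌊y⌋, c := Finset.sum_le_sum fun z _ => hz z
    _ = k * c := by simp

end


/-! ### The defect of the weighted sum -/

/-- The distribution function of `∑_{k ∈ t} k X_k`. -/
noncomputable def wsumCdf {Ω : Type*} [MeasurableSpace Ω] (P : Measure Ω) (X : ℕ → Ω → ℝ)
    (t : Finset ℕ) (x : ℝ) : ℝ := (wsumLaw P X t).real (Iic x)

/-- The rescaled defect of the law of `∑_{k=l}^n k X_k` in the Dickman equation. -/
noncomputable def sumDefect {Ω : Type*} [MeasurableSpace Ω] (P : Measure Ω) (X : ℕ → Ω → ℝ)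
    (θ β : ℝ) (l n : ℕ) (x : ℝ) : ℝ :=
  ∑ k ∈ Finset.Icc l n, k * successProb θ β k * wsumCdf P X ((Finset.Icc l n).erase k) (x - k)
    - θ * ∫ y in (x - n)..x, wsumCdf P X (Finset.Icc l n) y

/-- The part of the defect due to the correlation between the sum and its summands. -/
noncomputable def dependenceDefect {Ω : Type*} [MeasurableSpace Ω] (P : Measure Ω)
    (X : ℕ → Ω → ℝ) (θ β : ℝ) (l n : ℕ) (x : ℝ) : ℝ :=
  ∑ k ∈ Finset.Icc l n, successProb θ β k *
    (wsumCdf P X ((Finset.Icc l n).erase k) (x - k)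
      - wsumCdf P X ((Finset.Icc l n).erase k) (x - k - k))

/-- The part of the defect due to the shift `β` of the success probabilities. -/
noncomputable def shiftDefect {Ω : Type*} [MeasurableSpace Ω] (P : Measure Ω)
    (X : ℕ → Ω → ℝ) (β : ℝ) (l n : ℕ) (x : ℝ) : ℝ :=
  ∑ k ∈ Finset.Icc l n, 1 / (k + β) * wsumCdf P X ((Finset.Icc l n).erase k) (x - k)

/-- By monotonicity the integral lies between the sums over `1 ≤ k ≤ n` and `0 ≤ k < n`, which
differ by at most `G x`. The missing indices `1 ≤ k < l` cost at most `(l - 1) G x`. -/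
lemma abs_integral_sub_sum_le {G : ℝ → ℝ} (hG : Monotone G) (h0 : ∀ y, 0 ≤ G y) {l n : ℕ}
    (hl1 : 1 ≤ l) (hln : l ≤ n) (x : ℝ) :
    |∑ k ∈ Finset.Icc l n, G (x - k) - ∫ y in (x - n)..x, G y| ≤ l * G x := by
  have hsum : ∀ j : ℕ, ∑ i ∈ Finset.range n, G (x - n + ↑(i + j))
      = ∑ i ∈ Finset.range n, G (x - (n - 1 - i : ℕ) - 1 + j) := by
    intro j
    refine Finset.sum_congr rfl fun i hi => ?_
    have : i + 1 ≤ n := Finset.mem_range.1 hi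
    congr 1
    rw [show n - 1 - i = n - (i + 1) by omega, Nat.cast_sub this]
    push_cast
    ring
  have h1 := (hG.monotoneOn _).sum_le_integral (x₀ := x - n) (a := n)
  have h2 := (hG.monotoneOn _).integral_le_sum (x₀ := x - n) (a := n)
  have e1 := hsum 0
  have e2 := hsum 1
  rw [Finset.sum_range_reflect (fun i => G (x - (i : ℕ) - 1 + (0 : ℕ)))] at e1
  rw [Finset.sum_range_reflect (fun i => G (x - (i : ℕ) - 1 + (1 : ℕ)))] at e2
  simp only [add_zero] at e1
  rw [e1, sub_add_cancel] at h1
  rw [e2, sub_add_cancel] at h2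
  simp only [Nat.cast_zero, add_zero, Nat.cast_one, sub_add_cancel] at h1 h2
  have e3 : ∑ i ∈ Finset.range n, G (x - i - 1) = ∑ k ∈ Finset.Ico 1 (n + 1), G (x - k) := by
    rw [Finset.sum_Ico_eq_sum_range]
    refine Finset.sum_congr rfl fun i _ => ?_
    push_cast
    ring_nf
  have e4 : ∑ k ∈ Finset.Ico 1 (n + 1), G (x - k)
      = ∑ k ∈ Finset.Ico 1 l, G (x - k) + ∑ k ∈ Finset.Icc l n, G (x - k) := by
    rw [← Finset.Ico_add_one_right_eq_Icc, Finset.sum_Ico_consecutive _ hl1 (by omega)]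
  have e5 : ∑ i ∈ Finset.range n, G (x - i) ≤ G x + ∑ i ∈ Finset.range n, G (x - i - 1) := by
    have h3 := Finset.sum_range_succ' (fun i : ℕ => G (x - i)) n
    rw [Finset.sum_range_succ] at h3
    have h4 : ∑ i ∈ Finset.range n, G (x - ↑(i + 1)) = ∑ i ∈ Finset.range n, G (x - i - 1) := by
      refine Finset.sum_congr rfl fun i _ => ?_
      push_cast
      ring_nf
    rw [h4] at h3
    simp only [Nat.cast_zero, sub_zero] at h3
    linarith [h0 (x - n)]
  have e6 : ∑ k ∈ Finset.Ico 1 l, G (x - k) ≤ (l - 1) * G x := by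
    have : ∑ k ∈ Finset.Ico 1 l, G (x - k) ≤ ∑ k ∈ Finset.Ico 1 l, G x :=
      Finset.sum_le_sum fun k _ => hG (sub_le_self x k.cast_nonneg)
    rw [Finset.sum_const, Nat.card_Ico, nsmul_eq_mul, Nat.cast_sub hl1, Nat.cast_one] at this
    exact this
  have e7 : 0 ≤ ∑ k ∈ Finset.Ico 1 l, G (x - k) := Finset.sum_nonneg fun k _ => h0 _
  have e8 := h0 x
  have e9 : 0 ≤ (l : ℝ) * G x := by positivity
  rw [abs_le]
  constructor <;> linarith

lemma wsumCdf_nonneg {Ω : Type*} [MeasurableSpace Ω] {P : Measure Ω} {X : ℕ → Ω → ℝ}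
    (t : Finset ℕ) (x : ℝ) : 0 ≤ wsumCdf P X t x := measureReal_nonneg

lemma IsBernoulliArray.wsumCdf_of_neg {Ω : Type*} [MeasurableSpace Ω] {P : Measure Ω} {X : ℕ → Ω → ℝ}
    {s t : Finset ℕ} {p : ℕ → ℝ}
    (h : IsBernoulliArray P s p X) (ht : t ⊆ s) {x : ℝ} (hx : x < 0) : wsumCdf P X t x = 0 := by
  rw [wsumCdf, measureReal_def, measure_mono_null (Iic_subset_Iio.2 hx) (h.Iio_zero ht)]
  rfl

lemma shiftDefect_nonneg {θ β : ℝ} {l n : ℕ} {Ω : Type*} [MeasurableSpace Ω] {P : Measure Ω}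
    {X : ℕ → Ω → ℝ} (hθ : 0 < θ) (hl : θ - β ≤ l) (x : ℝ) :
    0 ≤ shiftDefect P X β l n x :=
  Finset.sum_nonneg fun _ hk => mul_nonneg
    (one_div_nonneg.2 (hθ.le.trans (le_add_of_le hl (Finset.mem_Icc.1 hk).1)))
    (wsumCdf_nonneg _ _)

/-- Dropping the subtracted term is crude, since it loses a logarithm, but suffices for `θ < 1`. -/
lemma dependenceDefect_le_shiftDefect {θ β : ℝ} {l n : ℕ} {Ω : Type*} [MeasurableSpace Ω] {P : Measure Ω}
    {X : ℕ → Ω → ℝ} (hθ : 0 < θ) (hl : θ - β ≤ l) (x : ℝ) :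
    dependenceDefect P X θ β l n x ≤ θ * shiftDefect P X β l n x := by
  rw [dependenceDefect, shiftDefect, Finset.mul_sum]
  refine Finset.sum_le_sum fun k hk => ?_
  have h1 := successProb_nonneg hθ hl (Finset.mem_Icc.1 hk).1
  have h2 := wsumCdf_nonneg (P := P) (X := X) ((Finset.Icc l n).erase k) (x - k - k)
  rw [← mul_assoc, mul_one_div]
  exact mul_le_mul_of_nonneg_left (by linarith) h1

section

variable {θ β : ℝ} {l n : ℕ} {Ω : Type*} [MeasurableSpace Ω] {P : Measure Ω}
  [IsProbabilityMeasure P] {X : ℕ → Ω → ℝ}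

lemma IsBernoulliArray.monotone_wsumCdf {s t : Finset ℕ} {p : ℕ → ℝ}
    (h : IsBernoulliArray P s p X) (ht : t ⊆ s) : Monotone (wsumCdf P X t) := by
  have := h.isProbabilityMeasure ht
  exact fun x y hxy => measureReal_mono (Iic_subset_Iic.2 hxy)

lemma IsBernoulliArray.wsumCdf_le_one {s t : Finset ℕ} {p : ℕ → ℝ}
    (h : IsBernoulliArray P s p X) (ht : t ⊆ s) (x : ℝ) : wsumCdf P X t x ≤ 1 := by
  have := h.isProbabilityMeasure ht
  exact measureReal_le_one

lemma IsBernoulliArray.wsumCdf_eq {s : Finset ℕ} {p : ℕ → ℝ} (h : IsBernoulliArray P s p X)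
    {k : ℕ} (hk : k ∈ s) (x : ℝ) :
    wsumCdf P X s x = (1 - p k) * wsumCdf P X (s.erase k) x
      + p k * wsumCdf P X (s.erase k) (x - k) := by
  have := h.real_eq hk (measurableSet_Iic (a := x))
  have e : (fun y : ℝ => y + k) ⁻¹' Iic x = Iic (x - k) := by
    ext y
    change y + k ≤ x ↔ y ≤ x - k
    constructor <;> intro _ <;> linarith
  rwa [e] at this

/-- Decomposition of the defect. -/
lemma sumDefect_eq (hθ : 0 < θ) (hl : θ - β ≤ l)
    (h : IsBernoulliArray P (Finset.Icc l n) (successProb θ β) X) (x : ℝ) :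
    sumDefect P X θ β l n x =
      θ * (∑ k ∈ Finset.Icc l n, wsumCdf P X (Finset.Icc l n) (x - k)
        - ∫ y in (x - n)..x, wsumCdf P X (Finset.Icc l n) y)
      + θ * dependenceDefect P X θ β l n x - θ * β * shiftDefect P X β l n x := by
  have key : ∑ k ∈ Finset.Icc l n, k * successProb θ β k *
      wsumCdf P X ((Finset.Icc l n).erase k) (x - k)
      = θ * ∑ k ∈ Finset.Icc l n, wsumCdf P X (Finset.Icc l n) (x - k)
        + θ * dependenceDefect P X θ β l n x - θ * β * shiftDefect P X β l n x := by
    rw [dependenceDefect, shiftDefect, Finset.mul_sum, Finset.mul_sum, Finset.mul_sum,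
      ← Finset.sum_add_distrib, ← Finset.sum_sub_distrib]
    refine Finset.sum_congr rfl fun k hk => ?_
    -- The second identity expresses `G_k(x - k)` as `G(x - k)` plus `p_k (G_k(x - k) - G_k(x -
    -- 2k))`, the summand of the dependence term.
    rw [mul_successProb hθ hl (Finset.mem_Icc.1 hk).1, h.wsumCdf_eq hk (x - k)]
    ring
  rw [sumDefect, key]
  ring

lemma dependenceDefect_nonneg (hθ : 0 < θ) (hl : θ - β ≤ l)
    (h : IsBernoulliArray P (Finset.Icc l n) (successProb θ β) X) (x : ℝ) :
    0 ≤ dependenceDefect P X θ β l n x :=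
  Finset.sum_nonneg fun k hk => mul_nonneg
    (successProb_nonneg hθ hl (Finset.mem_Icc.1 hk).1) (sub_nonneg.2
      (h.monotone_wsumCdf (Finset.erase_subset k _) (sub_le_self _ k.cast_nonneg)))

/-- Only indices `k ≤ min x n` contribute. There each distribution function is at most the lower
tail at `x`, and the weights form a harmonic sum. -/
lemma shiftDefect_le (hθ : 0 < θ) (hl : θ - β ≤ l) (hl1 : 1 ≤ l) (hln : l ≤ n)
    (h : IsBernoulliArray P (Finset.Icc l n) (successProb θ β) X) {x : ℝ} (hx : l ≤ x) :
    shiftDefect P X β l n x ≤ tailConst θ β * (min x n / n) ^ θ *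
      ((1 + |β| / θ) * (1 + Real.log (min x n / l))) := by
  have hl0 : (0 : ℝ) < l := by exact_mod_cast hl1
  have hn0 : (0 : ℝ) < n := by exact_mod_cast hl1.trans hln
  have hln' : (l : ℝ) ≤ n := by exact_mod_cast hln
  have hC := one_le_tailConst β hθ
  set z := min x (n : ℝ) with hz
  have hlz : (l : ℝ) ≤ z := le_min hx hln'
  have hz0 : 0 < z := hl0.trans_le hlz
  have hlN : l ≤ ⌊z⌋₊ := Nat.le_floor hlz
  have h1 : ∀ k ∈ Finset.Icc l n, 1 / (k + β) * wsumCdf P X ((Finset.Icc l n).erase k) (x - k)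
      ≤ if k ∈ Finset.Icc l ⌊z⌋₊ then
        tailConst θ β * (z / n) ^ θ * ((1 + |β| / θ) * (1 / k)) else 0 := by
    intro k hk
    have hlk := (Finset.mem_Icc.1 hk).1
    have hkn : (k : ℝ) ≤ n := by exact_mod_cast (Finset.mem_Icc.1 hk).2
    have hpos : 0 < (k : ℝ) + β := hθ.trans_le (le_add_of_le hl hlk)
    split_ifs with hkz
    · have h2 : wsumCdf P X ((Finset.Icc l n).erase k) (x - k) ≤ tailConst θ β * (z / n) ^ θ :=
        (h.monotone_wsumCdf (Finset.erase_subset k _) (sub_le_self _ k.cast_nonneg)).trans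
          (real_Iic_erase_le_of_le hθ hl hl1 hln h k hx)
      rw [mul_comm]
      exact mul_le_mul h2 (inv_add_le hθ hl hl1 hlk) (by positivity) (by positivity)
    · have h2 : x < k := by
        by_contra hcon
        exact hkz (Finset.mem_Icc.2 ⟨hlk, Nat.le_floor (le_min (not_lt.1 hcon) hkn)⟩)
      rw [h.wsumCdf_of_neg (Finset.erase_subset k _) (sub_neg.2 h2), mul_zero]
  refine (Finset.sum_le_sum h1).trans ?_
  rw [← Finset.sum_filter]
  have h3 : (Finset.Icc l n).filter (fun k => k ∈ Finset.Icc l ⌊z⌋₊) ⊆ Finset.Icc l ⌊z⌋₊ :=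
    fun k hk => (Finset.mem_filter.1 hk).2
  refine (Finset.sum_le_sum_of_subset_of_nonneg h3 fun _ _ _ => by positivity).trans ?_
  rw [← Finset.mul_sum, ← Finset.mul_sum]
  have h4 := sum_inv_le_log hl1 hlN
  have h5 : Real.log (⌊z⌋₊ / l) ≤ Real.log (z / l) := by
    have : (0 : ℝ) < ⌊z⌋₊ := hl0.trans_le (by exact_mod_cast hlN)
    refine Real.log_le_log (by positivity) ?_
    gcongr
    exact Nat.floor_le hz0.le
  gcongr
  linarith

/-- The constant in the bound for the dependence defect. -/
noncomputable def dependenceConst (θ β : ℝ) : ℝ :=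
  2 * (θ + |β|) * atomConst θ β + ⌈2 * θ + |β|⌉₊ * tailConst θ β

/-- The increment over an interval of length `k` is `O(k l / n)` by the atom bound, and the factor
`k` is compensated by `p_k`, as `k p_k` is bounded. Thus each of the at most `min x n` contributing
indices costs `O(l / n)`; the boundedly many large probabilities are handled by the lower tail. -/
lemma dependenceDefect_le (hθ1 : 1 ≤ θ) (hl : θ - β ≤ l) (hl1 : 1 ≤ l) (hln : l ≤ n)
    (h : IsBernoulliArray P (Finset.Icc l n) (successProb θ β) X) {x : ℝ} (hx : l ≤ x) :
    dependenceDefect P X θ β l n x ≤ dependenceConst θ β * (l * (min x n / n)) := by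
  have hθ : 0 < θ := one_pos.trans_le hθ1
  have hl0 : (0 : ℝ) < l := by exact_mod_cast hl1
  have hl1' : (1 : ℝ) ≤ l := by exact_mod_cast hl1
  have hn0 : (0 : ℝ) < n := by exact_mod_cast hl1.trans hln
  have hln' : (l : ℝ) ≤ n := by exact_mod_cast hln
  have hC := one_le_tailConst β hθ
  have hb := abs_nonneg β
  have hprob := h.isProbabilityMeasure subset_rfl
  have hA : 0 ≤ atomConst θ β := by unfold atomConst; positivity
  set s := Finset.Icc l n with hs
  set z := min x (n : ℝ) with hz
  have hlz : (l : ℝ) ≤ z := le_min hx hln'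
  have hz0 : 0 < z := hl0.trans_le hlz
  set M := 2 * (θ + |β|) * (atomConst θ β * (l / n)) with hM
  have hM0 : 0 ≤ M := by positivity
  have hterm : ∀ k ∈ s, successProb θ β k * (wsumCdf P X (s.erase k) (x - k)
      - wsumCdf P X (s.erase k) (x - k - k)) ≤ (if k ∈ Finset.Icc 1 ⌊z⌋₊ then M else 0)
        + if k ∈ largeProbIndices θ β s then tailConst θ β * (z / n) else 0 := by
    intro k hk
    have hlk := (Finset.mem_Icc.1 hk).1
    have hk0 : (0 : ℝ) ≤ k := k.cast_nonneg
    have hkn : (k : ℝ) ≤ n := by exact_mod_cast (Finset.mem_Icc.1 hk).2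
    have hp0 := successProb_nonneg hθ hl hlk
    have hp1 := successProb_le_one hθ hl hlk
    have hprob' := h.isProbabilityMeasure (Finset.erase_subset k s)
    have hmono := h.monotone_wsumCdf (Finset.erase_subset k s)
    have hi1 : (0 : ℝ) ≤ if k ∈ Finset.Icc 1 ⌊z⌋₊ then M else 0 := by split_ifs <;> positivity
    have hi2 : (0 : ℝ) ≤ if k ∈ largeProbIndices θ β s then tailConst θ β * (z / n) else 0 := by
      split_ifs <;> positivity
    rcases lt_or_ge x k with hxk | hxk
    · rw [h.wsumCdf_of_neg (Finset.erase_subset k s) (by linarith : x - k < 0),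
        h.wsumCdf_of_neg (Finset.erase_subset k s) (by linarith : x - k - k < 0)]
      linarith
    by_cases hbad : k ∈ largeProbIndices θ β s
    · have h1 : wsumCdf P X (s.erase k) (x - k) ≤ tailConst θ β * (z / n) :=
        (hmono (by linarith)).trans (real_Iic_erase_le_linear hθ1 hl hl1 hln h k hx)
      have h2 := wsumCdf_nonneg (P := P) (X := X) (s.erase k) (x - k - k)
      have h3 := wsumCdf_nonneg (P := P) (X := X) (s.erase k) (x - k)
      rw [if_pos hbad]
      nlinarith
    · have hkN : k ∈ Finset.Icc 1 ⌊z⌋₊ :=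
        Finset.mem_Icc.2 ⟨hl1.trans hlk, Nat.le_floor (le_min hxk hkn)⟩
      have hgood : 2 * θ ≤ k + β := by
        by_contra hcon
        exact hbad (Finset.mem_filter.2 ⟨hk, not_le.1 hcon⟩)
      rw [if_pos hkN]
      have e : wsumCdf P X (s.erase k) (x - k) - wsumCdf P X (s.erase k) (x - k - k)
          = (wsumLaw P X (s.erase k)).real (Ioc (x - k - k) (x - k)) := by
        have hIoc : Ioc (x - k - k) (x - k) = Iic (x - k) \ Iic (x - k - k) := by
          ext y
          simp [and_comm]
        rw [hIoc, measureReal_sdiff (Iic_subset_Iic.2 (by linarith)) measurableSet_Iic]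
        rfl
      have h1 := real_erase_le_two_mul hθ hl h hk hgood (measurableSet_Ioc (a := x - k - k)
        (b := x - k))
      have h2 := real_Ioc_le_of_singleton (h.ae_natCast subset_rfl)
        (real_singleton_natCast_le hθ1 hl hl1 hln h) (x - k) k
      have h3 := mul_successProb_le hθ hl hl1 hlk
      rw [e]
      calc successProb θ β k * (wsumLaw P X (s.erase k)).real (Ioc (x - k - k) (x - k))
          ≤ successProb θ β k * (2 * (k * (atomConst θ β * (l / n)))) := by
            gcongr
            exact h1.trans (by gcongr)
        _ = 2 * (k * successProb θ β k) * (atomConst θ β * (l / n)) := by ring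
        _ ≤ M := by rw [hM]; gcongr
        _ ≤ _ := le_add_of_nonneg_right hi2
  refine (Finset.sum_le_sum hterm).trans ?_
  rw [Finset.sum_add_distrib, ← Finset.sum_filter, ← Finset.sum_filter, Finset.sum_const,
    Finset.sum_const, nsmul_eq_mul, nsmul_eq_mul]
  have c1 : ((s.filter fun k => k ∈ Finset.Icc 1 ⌊z⌋₊).card : ℝ) ≤ z := by
    have h3 : (s.filter fun k => k ∈ Finset.Icc 1 ⌊z⌋₊) ⊆ Finset.Icc 1 ⌊z⌋₊ :=
      fun k hk => (Finset.mem_filter.1 hk).2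
    have h4 := Finset.card_le_card h3
    rw [Nat.card_Icc, Nat.add_sub_cancel] at h4
    exact (Nat.cast_le.2 h4).trans (Nat.floor_le hz0.le)
  have c2 : ((s.filter fun k => k ∈ largeProbIndices θ β s).card : ℝ) ≤ ⌈2 * θ + |β|⌉₊ := by
    have h3 : (s.filter fun k => k ∈ largeProbIndices θ β s) ⊆ largeProbIndices θ β s :=
      fun k hk => (Finset.mem_filter.1 hk).2
    exact_mod_cast (Finset.card_le_card h3).trans (card_largeProbIndices_le θ β s)
  calc _ ≤ z * M + ⌈2 * θ + |β|⌉₊ * (tailConst θ β * (z / n)) := by gcongr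
    _ ≤ z * M + ⌈2 * θ + |β|⌉₊ * (tailConst θ β * (l * (z / n))) := by
      gcongr
      exact le_mul_of_one_le_left (by positivity) hl1'
    _ = _ := by rw [hM, dependenceConst]; ring

/-- Isolates the shift term, the only possible source of a logarithm for `θ ≥ 1`; both the upper and
the logarithmic lower bound start from here. -/
lemma abs_sumDefect_add_le (hθ : 0 < θ) (hl : θ - β ≤ l) (hl1 : 1 ≤ l) (hln : l ≤ n)
    (h : IsBernoulliArray P (Finset.Icc l n) (successProb θ β) X) (x : ℝ) :
    |sumDefect P X θ β l n x + θ * β * shiftDefect P X β l n x|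
      ≤ θ * (l * wsumCdf P X (Finset.Icc l n) x) + θ * dependenceDefect P X θ β l n x := by
  have h1 := abs_integral_sub_sum_le (h.monotone_wsumCdf subset_rfl) (wsumCdf_nonneg _) hl1 hln x
  have h2 := dependenceDefect_nonneg hθ hl h x
  rw [sumDefect_eq hθ hl h, sub_add_cancel]
  refine (abs_add_le _ _).trans ?_
  rw [abs_mul, abs_mul, abs_of_pos hθ, abs_of_nonneg h2]
  gcongr

/-- Below `l` every argument `x - k` is negative, so only the integral over `[0, x]` survives; this
gives the decay in `x` required for stability. -/
lemma abs_sumDefect_le_of_lt (hθ : 0 < θ) (hl : θ - β ≤ l) (hl1 : 1 ≤ l) (hln : l ≤ n)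
    (h : IsBernoulliArray P (Finset.Icc l n) (successProb θ β) X) {x : ℝ} (hx0 : 0 ≤ x)
    (hx : x < l) : |sumDefect P X θ β l n x| ≤ θ * tailConst θ β * (l / n) ^ θ * x := by
  have hln' : (l : ℝ) ≤ n := by exact_mod_cast hln
  have hmono := h.monotone_wsumCdf subset_rfl
  have e1 : ∑ k ∈ Finset.Icc l n, k * successProb θ β k *
      wsumCdf P X ((Finset.Icc l n).erase k) (x - k) = 0 := by
    refine Finset.sum_eq_zero fun k hk => ?_
    have : (l : ℝ) ≤ k := by exact_mod_cast (Finset.mem_Icc.1 hk).1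
    rw [h.wsumCdf_of_neg (Finset.erase_subset k _) (by linarith), mul_zero]
  have hG : wsumCdf P X (Finset.Icc l n) x ≤ tailConst θ β * (l / n) ^ θ := by
    have := (hmono hx.le).trans (real_Iic_le_of_le hθ hl hl1 hln h le_rfl)
    rwa [min_eq_left hln'] at this
  have e2 : ∫ y in (x - n)..x, wsumCdf P X (Finset.Icc l n) y
      = ∫ y in (0 : ℝ)..x, wsumCdf P X (Finset.Icc l n) y := by
    rw [← intervalIntegral.integral_add_adjacent_intervals (b := 0) hmono.intervalIntegrable
      hmono.intervalIntegrable, add_eq_right, intervalIntegral.integral_of_le (by linarith),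
      integral_Ioc_eq_integral_Ioo, setIntegral_congr_fun (g := fun _ => 0) measurableSet_Ioo]
    · simp
    · exact fun y hy => h.wsumCdf_of_neg subset_rfl hy.2
  have e3 : |∫ y in (0 : ℝ)..x, wsumCdf P X (Finset.Icc l n) y|
      ≤ tailConst θ β * (l / n) ^ θ * x := by
    have := intervalIntegral.norm_integral_le_of_norm_le_const (a := 0) (b := x)
      (C := tailConst θ β * (l / n) ^ θ) (f := wsumCdf P X (Finset.Icc l n)) (fun y hy => by
        rw [uIoc_of_le hx0] at hy
        rw [Real.norm_eq_abs, abs_of_nonneg (wsumCdf_nonneg _ _)]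
        exact (hmono hy.2).trans hG)
    rwa [sub_zero, abs_of_nonneg hx0] at this
  rw [sumDefect, e1, e2, zero_sub, abs_neg, abs_mul, abs_of_pos hθ]
  calc _ ≤ θ * (tailConst θ β * (l / n) ^ θ * x) := by gcongr
    _ = _ := by ring

end


/-! ### Bounds for the defect -/

section

variable {θ β : ℝ} {l n : ℕ} {Ω : Type*} [MeasurableSpace Ω] {P : Measure Ω}
  [IsProbabilityMeasure P] {X : ℕ → Ω → ℝ}

/-- The constant in the defect bound for `θ < 1`. -/
noncomputable def defectConstLt (θ β : ℝ) : ℝ :=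
  (θ + θ * (θ + |β|) * ((1 + |β| / θ) * (1 + 1 / (1 - θ)))) * tailConst θ β

/-- With `z = min x n`, all terms are `O((z / n) ^ θ (l + log (z / l)))`. As `θ < 1`, the logarithm
is dominated by `(z / l) ^ (1 - θ)`, and `(z / n) ^ θ l (z / l) ^ (1 - θ) = (l / n) ^ θ z`. -/
lemma abs_sumDefect_le_of_lt_one (hθ : 0 < θ) (hθ1 : θ < 1) (hl : θ - β ≤ l) (hl1 : 1 ≤ l)
    (hln : l ≤ n) (h : IsBernoulliArray P (Finset.Icc l n) (successProb θ β) X) {x : ℝ}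
    (hx0 : 0 ≤ x) : |sumDefect P X θ β l n x| ≤ defectConstLt θ β * (l / n) ^ θ * min x n := by
  have hl0 : (0 : ℝ) < l := by exact_mod_cast hl1
  have hl1' : (1 : ℝ) ≤ l := by exact_mod_cast hl1
  have hn0 : (0 : ℝ) < n := by exact_mod_cast hl1.trans hln
  have hln' : (l : ℝ) ≤ n := by exact_mod_cast hln
  have hT := one_le_tailConst β hθ
  have hb := abs_nonneg β
  have hs : 0 < 1 - θ := by linarith
  set A := θ * (θ + |β|) * ((1 + |β| / θ) * (1 + 1 / (1 - θ))) with hA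
  have hA0 : 0 ≤ A := by positivity
  rcases lt_or_ge x l with hx | hx
  · rw [min_eq_left (hx.le.trans hln')]
    refine (abs_sumDefect_le_of_lt hθ hl hl1 hln h hx0 hx).trans ?_
    unfold defectConstLt
    gcongr
    linarith
  set z := min x (n : ℝ) with hz
  have hlz : (l : ℝ) ≤ z := le_min hx hln'
  have hz0 : 0 < z := hl0.trans_le hlz
  have hzl : 1 ≤ z / l := (one_le_div hl0).2 hlz
  have hpow : 1 ≤ (z / l) ^ (1 - θ) := Real.one_le_rpow hzl hs.le
  have hlog : 1 + Real.log (z / l) ≤ (1 + 1 / (1 - θ)) * (z / l) ^ (1 - θ) := by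
    have := Real.log_le_rpow_div (x := z / l) (by positivity) hs
    rw [add_mul, one_mul, one_div_mul_eq_div]
    linarith
  have hG := real_Iic_le_of_le hθ hl hl1 hln h hx
  have hsh := shiftDefect_le hθ hl hl1 hln h hx
  have hsh0 := shiftDefect_nonneg (P := P) (X := X) (n := n) hθ hl x
  have hdep := dependenceDefect_le_shiftDefect (P := P) (X := X) (n := n) hθ hl x
  have hQ := abs_sumDefect_add_le hθ hl hl1 hln h x
  have htri : |sumDefect P X θ β l n x| ≤ θ * (l * wsumCdf P X (Finset.Icc l n) x)
      + θ * (θ + |β|) * shiftDefect P X β l n x := by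
    have h1 := abs_sub (sumDefect P X θ β l n x + θ * β * shiftDefect P X β l n x)
      (θ * β * shiftDefect P X β l n x)
    rw [add_sub_cancel_right, abs_mul (θ * β), abs_mul θ, abs_of_pos hθ, abs_of_nonneg hsh0] at h1
    have h2 := mul_le_mul_of_nonneg_left hdep hθ.le
    linarith
  set τ := tailConst θ β * (z / n) ^ θ with hτ
  have hτ0 : 0 ≤ τ := by positivity
  have hzn : τ * (l * (z / l) ^ (1 - θ)) = tailConst θ β * (l / n) ^ θ * z := by
    have e1 : (z / l) ^ (1 - θ) = z / l / (z / l) ^ θ := by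
      rw [Real.rpow_sub (by positivity), Real.rpow_one]
    have e2 : (z / n) ^ θ = (z / l) ^ θ * (l / n) ^ θ := by
      rw [← Real.mul_rpow (by positivity) (by positivity)]
      congr 1
      field_simp
    have e3 : (z / l) ^ θ ≠ 0 := (Real.rpow_pos_of_pos (by positivity) θ).ne'
    rw [hτ, e1, e2]
    field_simp
  calc |sumDefect P X θ β l n x|
      ≤ θ * (l * τ) + θ * (θ + |β|) * (τ * ((1 + |β| / θ) *
          ((1 + 1 / (1 - θ)) * (z / l) ^ (1 - θ)))) := by
        refine htri.trans ?_
        gcongr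
        · exact hG
        · exact hsh.trans (by gcongr)
    _ = θ * (τ * (l * 1)) + A * (τ * (1 * (z / l) ^ (1 - θ))) := by rw [hA]; ring
    _ ≤ θ * (τ * (l * (z / l) ^ (1 - θ))) + A * (τ * (l * (z / l) ^ (1 - θ))) := by gcongr
    _ = defectConstLt θ β * (l / n) ^ θ * z := by rw [hzn, defectConstLt]; ring

/-- The constant in the defect bound for `θ ≥ 1`. -/
noncomputable def defectConstGe (θ β : ℝ) : ℝ :=
  θ * (tailConst θ β + dependenceConst θ β + tailConst θ β * (1 + |β| / θ) * (1 + |β|))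

lemma dependenceConst_nonneg (hθ : 0 < θ) : 0 ≤ dependenceConst θ β := by
  have hT := one_le_tailConst β hθ
  unfold dependenceConst atomConst
  positivity

/-- For `θ ≥ 1` the lower tail is at most linear in `z = min x n`, so every term acquires the factor
`z / n`; the logarithm is simply bounded by `log (n / l)`. -/
lemma abs_sumDefect_le_of_one_le (hθ1 : 1 ≤ θ) (hl : θ - β ≤ l) (hl1 : 1 ≤ l)
    (hln : l ≤ n) (h : IsBernoulliArray P (Finset.Icc l n) (successProb θ β) X) {x : ℝ}
    (hx0 : 0 ≤ x) : |sumDefect P X θ β l n x|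
      ≤ defectConstGe θ β * ((l + |β| * Real.log (n / l)) / n) * min x n := by
  have hθ : 0 < θ := one_pos.trans_le hθ1
  have hl0 : (0 : ℝ) < l := by exact_mod_cast hl1
  have hl1' : (1 : ℝ) ≤ l := by exact_mod_cast hl1
  have hn0 : (0 : ℝ) < n := by exact_mod_cast hl1.trans hln
  have hln' : (l : ℝ) ≤ n := by exact_mod_cast hln
  have hT := one_le_tailConst β hθ
  have hD := dependenceConst_nonneg (β := β) hθ
  have hb := abs_nonneg β
  have hL : 0 ≤ Real.log (n / l) := Real.log_nonneg ((one_le_div hl0).2 hln')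
  have hbL : 0 ≤ |β| * Real.log (n / l) := by positivity
  set T := tailConst θ β with hTdef
  set D := dependenceConst θ β with hDdef
  set K := 1 + |β| / θ with hK
  have hK0 : 0 ≤ K := by positivity
  have hTK : 0 ≤ T * K := by positivity
  rcases lt_or_ge x l with hx | hx
  · rw [min_eq_left (hx.le.trans hln')]
    refine (abs_sumDefect_le_of_lt hθ hl hl1 hln h hx0 hx).trans ?_
    have h1 : (l / n : ℝ) ^ θ ≤ (l + |β| * Real.log (n / l)) / n :=
      (Real.rpow_le_self_of_le_one (by positivity) ((div_le_one hn0).2 hln') hθ1).trans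
        (by gcongr; linarith)
    unfold defectConstGe
    gcongr
    rw [add_assoc]
    exact le_add_of_nonneg_right (by positivity)
  set z := min x (n : ℝ) with hz
  have hlz : (l : ℝ) ≤ z := le_min hx hln'
  have hz0 : 0 < z := hl0.trans_le hlz
  have hG : wsumCdf P X (Finset.Icc l n) x ≤ T * (z / n) := real_Iic_le_linear hθ1 hl hl1 hln h hx
  have hsh : shiftDefect P X β l n x ≤ T * (z / n) * (K * (1 + Real.log (n / l))) := by
    refine (shiftDefect_le hθ hl hl1 hln h hx).trans ?_
    have h1 : (z / n) ^ θ ≤ z / n := Real.rpow_le_self_of_le_one (by positivity)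
      ((div_le_one hn0).2 (min_le_right _ _)) hθ1
    have h2 : Real.log (z / l) ≤ Real.log (n / l) :=
      Real.log_le_log (by positivity) (by gcongr; exact min_le_right _ _)
    have h3 : 0 ≤ Real.log (z / l) := Real.log_nonneg ((one_le_div hl0).2 hlz)
    gcongr
  have hsh0 := shiftDefect_nonneg (P := P) (X := X) (n := n) hθ hl x
  have hdep : dependenceDefect P X θ β l n x ≤ D * (l * (z / n)) :=
    dependenceDefect_le hθ1 hl hl1 hln h hx
  have hQ := abs_sumDefect_add_le hθ hl hl1 hln h x
  have htri : |sumDefect P X θ β l n x| ≤ θ * (l * wsumCdf P X (Finset.Icc l n) x)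
      + θ * dependenceDefect P X θ β l n x + θ * |β| * shiftDefect P X β l n x := by
    have h1 := abs_sub (sumDefect P X θ β l n x + θ * β * shiftDefect P X β l n x)
      (θ * β * shiftDefect P X β l n x)
    rw [add_sub_cancel_right, abs_mul (θ * β), abs_mul θ, abs_of_pos hθ, abs_of_nonneg hsh0] at h1
    linarith
  set L := Real.log (n / l) with hLdef
  calc |sumDefect P X θ β l n x|
      ≤ θ * (l * (T * (z / n))) + θ * (D * (l * (z / n)))
          + θ * |β| * (T * (z / n) * (K * (1 + L))) := by
        refine htri.trans ?_
        gcongr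
    _ = θ * (z / n) * (T * l + D * l + T * K * (|β| * 1 + |β| * L)) := by ring
    _ ≤ θ * (z / n) * (T * (l + |β| * L) + D * (l + |β| * L)
          + T * K * ((1 + |β|) * (l + |β| * L))) := by
        gcongr
        · linarith
        · linarith
        · nlinarith [mul_nonneg hb (mul_nonneg hb hL), mul_nonneg hb (sub_nonneg.2 hl1')]
    _ = defectConstGe θ β * ((l + |β| * L) / n) * z := by
        unfold defectConstGe
        ring

end

/-! ### The law of the normalized sum -/

lemma map_weightedSum_eq {θ β : ℝ} {l n : ℕ} {Ω : Type*} [MeasurableSpace Ω]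
    {P : Measure Ω} {X : ℕ → Ω → ℝ}
    (h : IsBernoulliArray P (Finset.Icc l n) (successProb θ β) X) :
    P.map (weightedSum X l n) = (wsumLaw P X (Finset.Icc l n)).map (fun x => (n : ℝ)⁻¹ * x) := by
  rw [wsumLaw, AEMeasurable.map_map_of_aemeasurable (by fun_prop)
    (h.aemeasurable_wsum subset_rfl)]
  rfl

lemma map_weightedSum_Iio {θ β : ℝ} {l n : ℕ} {Ω : Type*}
    [MeasurableSpace Ω] {P : Measure Ω} {X : ℕ → Ω → ℝ} (hn : 0 < n)
    (h : IsBernoulliArray P (Finset.Icc l n) (successProb θ β) X) :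
    P.map (weightedSum X l n) (Iio 0) = 0 := by
  have hn0 : (0 : ℝ) < n := by exact_mod_cast hn
  rw [map_weightedSum_eq h, Measure.map_apply (by fun_prop) measurableSet_Iio]
  refine measure_mono_null (fun x hx => ?_) (h.Iio_zero subset_rfl)
  have hx : (n : ℝ)⁻¹ * x < 0 := hx
  exact (pos_iff_neg_of_mul_neg hx).1 (by positivity)

section

variable {θ β : ℝ} {l n : ℕ} {Ω : Type*} [MeasurableSpace Ω] {P : Measure Ω}
  [IsProbabilityMeasure P] {X : ℕ → Ω → ℝ}

lemma isProbabilityMeasure_map_weightedSum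
    (h : IsBernoulliArray P (Finset.Icc l n) (successProb θ β) X) :
    IsProbabilityMeasure (P.map (weightedSum X l n)) := by
  have := h.isProbabilityMeasure subset_rfl
  rw [map_weightedSum_eq h]
  exact Measure.isProbabilityMeasure_map (by fun_prop)

lemma preimage_inv_mul_Iic (hn : 0 < n) (a : ℝ) :
    (fun x : ℝ => (n : ℝ)⁻¹ * x) ⁻¹' Iic a = Iic (n * a) := by
  have hn0 : (0 : ℝ) < n := by exact_mod_cast hn
  ext x
  exact inv_mul_le_iff₀ hn0

lemma cdf_map_weightedSum (hn : 0 < n)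
    (h : IsBernoulliArray P (Finset.Icc l n) (successProb θ β) X) (a : ℝ) :
    cdf (P.map (weightedSum X l n)) a = wsumCdf P X (Finset.Icc l n) (n * a) := by
  have := isProbabilityMeasure_map_weightedSum h
  rw [cdf_eq_real, map_weightedSum_eq h, map_measureReal_apply (by fun_prop) measurableSet_Iic,
    preimage_inv_mul_Iic hn, wsumCdf]

lemma truncatedMean_weightedSum (hn : 0 < n)
    (h : IsBernoulliArray P (Finset.Icc l n) (successProb θ β) X) (a : ℝ) :
    a * cdf (P.map (weightedSum X l n)) a - cdfInt (P.map (weightedSum X l n)) a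
      = (n : ℝ)⁻¹ * ∑ k ∈ Finset.Icc l n,
          k * successProb θ β k * wsumCdf P X ((Finset.Icc l n).erase k) (n * a - k) := by
  have := isProbabilityMeasure_map_weightedSum h
  have hm : Measurable fun x : ℝ => if x ≤ a then x else 0 :=
    Measurable.ite measurableSet_Iic measurable_id measurable_const
  rw [mul_cdf_sub_cdfInt (map_weightedSum_Iio hn h), map_weightedSum_eq h,
    integral_map (by fun_prop) hm.aestronglyMeasurable]
  have e : ∀ x : ℝ, (if (n : ℝ)⁻¹ * x ≤ a then (n : ℝ)⁻¹ * x else 0)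
      = (n : ℝ)⁻¹ * (x * (Iic (n * a)).indicator 1 x) := by
    intro x
    rw [← preimage_inv_mul_Iic hn]
    by_cases hx : (n : ℝ)⁻¹ * x ≤ a <;> simp [hx]
  simp only [e]
  rw [integral_const_mul, h.setIntegral_id measurableSet_Iic]
  congr 1
  refine Finset.sum_congr rfl fun k _ => ?_
  congr 2
  ext y
  change y + k ≤ n * a ↔ y ≤ n * a - k
  constructor <;> intro _ <;> linarith

/-- Rescaling by `n` turns the unit window of the delay equation into a window of length `n`. -/
lemma dickmanDefect_weightedSum (hn : 0 < n)
    (h : IsBernoulliArray P (Finset.Icc l n) (successProb θ β) X) (a : ℝ) :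
    dickmanDefect θ (P.map (weightedSum X l n)) a = (n : ℝ)⁻¹ * sumDefect P X θ β l n (n * a) := by
  have hn0 : (n : ℝ) ≠ 0 := by exact_mod_cast hn.ne'
  rw [dickmanDefect, truncatedMean_weightedSum hn h, sumDefect, cdfInt_sub]
  simp only [cdf_map_weightedSum hn h]
  rw [intervalIntegral.integral_comp_mul_left (wsumCdf P X (Finset.Icc l n)) hn0, smul_eq_mul,
    mul_sub (n : ℝ), mul_one]
  ring

lemma truncatedMean_weightedSum_le (hθ : 0 < θ) (hl : θ - β ≤ l) (hl1 : 1 ≤ l) (hln : l ≤ n)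
    (h : IsBernoulliArray P (Finset.Icc l n) (successProb θ β) X) (a : ℝ) :
    a * cdf (P.map (weightedSum X l n)) a - cdfInt (P.map (weightedSum X l n)) a ≤ θ + |β| := by
  have hn : 0 < n := hl1.trans hln
  have hn0 : (0 : ℝ) < n := by exact_mod_cast hn
  rw [truncatedMean_weightedSum hn h, inv_mul_le_iff₀ hn0]
  have h1 : ∀ k ∈ Finset.Icc l n, k * successProb θ β k *
      wsumCdf P X ((Finset.Icc l n).erase k) (n * a - k) ≤ θ + |β| := by
    intro k hk
    have h2 := mul_successProb_le hθ hl hl1 (Finset.mem_Icc.1 hk).1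
    have h3 := h.wsumCdf_le_one (Finset.erase_subset k _) (n * a - k)
    have h4 : 0 ≤ k * successProb θ β k :=
      mul_nonneg k.cast_nonneg (successProb_nonneg hθ hl (Finset.mem_Icc.1 hk).1)
    exact (mul_le_of_le_one_right h4 h3).trans h2
  refine (Finset.sum_le_card_nsmul _ _ _ h1).trans ?_
  rw [nsmul_eq_mul, Nat.card_Icc]
  gcongr
  omega

/-! ### The Kolmogorov distance -/

lemma kolmogorovDist_le {μ ν : Measure ℝ} [IsProbabilityMeasure μ] [IsProbabilityMeasure ν] {d : ℝ}
    (hd : ∀ a, 0 ≤ a → |cdf μ a - cdf ν a| ≤ d) : kolmogorovDist μ ν ≤ d := by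
  have : Nonempty (Ici (0 : ℝ)) := ⟨⟨0, self_mem_Ici⟩⟩
  refine ciSup_le fun a => ?_
  have := hd a a.2
  rwa [cdf_eq_real, cdf_eq_real] at this

lemma abs_cdf_sub_le_kolmogorovDist {μ ν : Measure ℝ} [IsProbabilityMeasure μ]
    [IsProbabilityMeasure ν] {a : ℝ} (ha : 0 ≤ a) : |cdf μ a - cdf ν a| ≤ kolmogorovDist μ ν := by
  rw [cdf_eq_real, cdf_eq_real]
  exact le_ciSup (bddAbove_kolmogorovDist μ ν) ⟨a, ha⟩

/-- The stability estimate after rescaling, with `M = θ + |β|` as the bound on the truncated means.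
-/
lemma kolmogorovDist_weightedSum_le (hθ : 0 < θ) (hl : θ - β ≤ l) (hl1 : 1 ≤ l) (hln : l ≤ n)
    (h : IsBernoulliArray P (Finset.Icc l n) (successProb θ β) X) {η : ℝ}
    (hη : ∀ x, 0 ≤ x → |sumDefect P X θ β l n x| ≤ η * min x n) :
    kolmogorovDist (P.map (weightedSum X l n)) (dickman hθ) ≤ (3 + 2 * θ + 1 / θ) * η := by
  have hn : 0 < n := hl1.trans hln
  have hn0 : (0 : ℝ) < n := by exact_mod_cast hn
  have hD := isDickman_dickman hθ
  have := hD.isProbabilityMeasure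
  have := isProbabilityMeasure_map_weightedSum h
  have hW := map_weightedSum_Iio hn h
  refine kolmogorovDist_le fun a ha => abs_cdf_sub_le_of_defect hθ hW hD
    (fun b hb => sub_cdfInt_le_of_truncated hW
      (truncatedMean_weightedSum_le hθ hl hl1 hln h) hb) (fun b hb => ?_) ha
  rw [dickmanDefect_weightedSum hn h, abs_mul, abs_of_pos (inv_pos.2 hn0), inv_mul_le_iff₀ hn0]
  refine (hη _ (by positivity)).trans (le_of_eq ?_)
  rw [mul_left_comm, mul_min_of_nonneg _ _ hn0.le, mul_one]

/-- Between consecutive lattice points only the Dickman distribution function increases. -/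
lemma cdf_dickman_sub_le (hn : 0 < n)
    (h : IsBernoulliArray P (Finset.Icc l n) (successProb θ β) X) {ν : Measure ℝ}
    [IsProbabilityMeasure ν] (m : ℕ) :
    cdf ν ((m + 1 / 2) / n) - cdf ν (m / n)
      ≤ 2 * kolmogorovDist (P.map (weightedSum X l n)) ν := by
  have hn0 : (0 : ℝ) < n := by exact_mod_cast hn
  have := isProbabilityMeasure_map_weightedSum h
  have e : wsumCdf P X (Finset.Icc l n) (m + 1 / 2) = wsumCdf P X (Finset.Icc l n) m := by
    refine measureReal_congr ?_
    filter_upwards [h.ae_natCast subset_rfl] with x hx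
    obtain ⟨j, rfl⟩ := hx
    refine propext ⟨fun hj => ?_, fun hj => ?_⟩
    · change (j : ℝ) ≤ m + 1 / 2 at hj
      have : (j : ℝ) < (m + 1 : ℕ) := by push_cast; linarith
      have hjm : j ≤ m := Nat.lt_succ_iff.1 (by exact_mod_cast this)
      exact (Nat.cast_le (α := ℝ)).2 hjm
    · change (j : ℝ) ≤ m at hj
      change (j : ℝ) ≤ m + 1 / 2
      linarith
  have h1 := abs_cdf_sub_le_kolmogorovDist (μ := P.map (weightedSum X l n)) (ν := ν)
    (a := (m + 1 / 2) / n) (by positivity)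
  have h2 := abs_cdf_sub_le_kolmogorovDist (μ := P.map (weightedSum X l n)) (ν := ν)
    (a := m / n) (by positivity)
  rw [cdf_map_weightedSum hn h, mul_div_cancel₀ _ hn0.ne'] at h1 h2
  rw [e] at h1
  linarith [(abs_le.1 h1).1, (abs_le.1 h2).2]

/-- For `b ≥ 2 E W` half of the mass lies below `b`. -/
lemma half_le_cdf_weightedSum (hθ : 0 < θ) (hl : θ - β ≤ l) (hl1 : 1 ≤ l) (hln : l ≤ n)
    (h : IsBernoulliArray P (Finset.Icc l n) (successProb θ β) X) :
    1 / 2 ≤ wsumCdf P X (Finset.Icc l n) (n * (2 * (θ + |β|))) := by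
  have hn : 0 < n := hl1.trans hln
  have := isProbabilityMeasure_map_weightedSum h
  have hb : 0 < θ + |β| := by positivity
  rw [← cdf_map_weightedSum hn h]
  set μ := P.map (weightedSum X l n)
  have h1 := sub_cdfInt_le_of_truncated (map_weightedSum_Iio hn h)
    (truncatedMean_weightedSum_le hθ hl hl1 hln h) (a := 2 * (θ + |β|)) (by positivity)
  -- With `b = 2 (θ + |β|)`, the previous bound reads `b - Φ(b) ≤ b / 2`; together with `Φ(b) ≤ b
  -- F(b)` it is Markov's inequality.
  have h2 : cdfInt μ (2 * (θ + |β|)) ≤ 2 * (θ + |β|) * cdf μ (2 * (θ + |β|)) := by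
    unfold cdfInt
    calc _ ≤ ∫ y in (0 : ℝ)..(2 * (θ + |β|)), cdf μ (2 * (θ + |β|)) :=
          intervalIntegral.integral_mono_on (by positivity) (intervalIntegrable_cdf μ _ _) (by simp)
            fun y hy => monotone_cdf μ hy.2
      _ = _ := by simp
  nlinarith

/-- At this argument every distribution function in the shift term is at least `1 / 2`, so the
weights alone yield a harmonic sum. -/
lemma log_le_shiftDefect (hθ : 0 < θ) (hl : θ - β ≤ l) (hl1 : 1 ≤ l) (hln : l ≤ n)
    (h : IsBernoulliArray P (Finset.Icc l n) (successProb θ β) X) :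
    1 / 2 * (Real.log n - Real.log (l + |β|))
      ≤ shiftDefect P X β l n (n * (2 * (θ + |β|) + 1)) := by
  have hb := abs_nonneg β
  have hl0 : (0 : ℝ) < l := by exact_mod_cast hl1
  have hn0 : (0 : ℝ) < n := by exact_mod_cast hl1.trans hln
  have h1 : Real.log n - Real.log (l + |β|) ≤ ∑ k ∈ Finset.Icc l n, 1 / ((k : ℝ) + |β|) := by
    have h2 := log_div_le_sum_inv hb (m := l - 1) (n := n) (by omega)
    rw [Nat.cast_sub hl1, Nat.sub_add_cancel hl1] at h2
    rw [← Real.log_div hn0.ne' (by positivity)]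
    refine le_trans (Real.log_le_log (by positivity) ?_) h2
    push_cast
    rw [sub_add_cancel]
    gcongr
    linarith
  refine (mul_le_mul_of_nonneg_left h1 (by norm_num)).trans ?_
  rw [Finset.mul_sum, shiftDefect]
  refine Finset.sum_le_sum fun k hk => ?_
  have hlk := (Finset.mem_Icc.1 hk).1
  have hkn : (k : ℝ) ≤ n := by exact_mod_cast (Finset.mem_Icc.1 hk).2
  have hpos : 0 < (k : ℝ) + β := hθ.trans_le (le_add_of_le hl hlk)
  rw [mul_comm]
  refine mul_le_mul ?_ ?_ (by norm_num) (by positivity)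
  · gcongr
    exact le_abs_self β
  -- The extra `+ 1` absorbs the displacement `k ≤ n`; removing a nonnegative summand only increases
  -- the distribution function.
  · set x := (n : ℝ) * (2 * (θ + |β|) + 1) with hx
    have hmono := h.monotone_wsumCdf (Finset.erase_subset k _)
    have h2 := half_le_cdf_weightedSum hθ hl hl1 hln h
    have h3 : wsumCdf P X (Finset.Icc l n) (n * (2 * (θ + |β|)))
        ≤ wsumCdf P X (Finset.Icc l n) (x - k) :=
      h.monotone_wsumCdf subset_rfl (by rw [hx]; linarith)
    have h4 := h.wsumCdf_eq hk (x - k)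
    have h5 := hmono (sub_le_self (x - k) (Nat.cast_nonneg (α := ℝ) k))
    have h6 := successProb_nonneg hθ hl hlk
    nlinarith

/-- The logarithmic lower bound, up to a constant. -/
lemma log_le_kolmogorovDist (hθ1 : 1 ≤ θ) (hθ : 0 < θ) (hl : θ - β ≤ l) (hl1 : 1 ≤ l)
    (hln : l ≤ n) (h : IsBernoulliArray P (Finset.Icc l n) (successProb θ β) X) :
    θ / 2 * (|β| * Real.log n) ≤ (2 + 2 * θ) * (2 * (θ + |β|) + 1) *
        (n * kolmogorovDist (P.map (weightedSum X l n)) (dickman hθ))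
      + (θ / 2 * (|β| * Real.log (l + |β|)) + θ * (1 + dependenceConst θ β) * l) := by
  have hn : 0 < n := hl1.trans hln
  have hb := abs_nonneg β
  have hl0 : (0 : ℝ) < l := by exact_mod_cast hl1
  have hln' : (l : ℝ) ≤ n := by exact_mod_cast hln
  have hn0 : (0 : ℝ) < n := by exact_mod_cast hn
  have hD := isDickman_dickman hθ
  have := hD.isProbabilityMeasure
  have := isProbabilityMeasure_map_weightedSum h
  set a := 2 * (θ + |β|) + 1 with ha
  have ha1 : 1 ≤ a := by rw [ha]; linarith
  have hna : (n : ℝ) ≤ n * a := le_mul_of_one_le_right hn0.le ha1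
  have h1 := abs_defect_le hθ hD (fun b hb => abs_cdf_sub_le_kolmogorovDist
    (μ := P.map (weightedSum X l n)) hb) ha1
  rw [dickmanDefect_weightedSum hn h, abs_mul, abs_of_pos (inv_pos.2 hn0),
    inv_mul_le_iff₀ hn0] at h1
  have h2 := abs_sumDefect_add_le hθ hl hl1 hln h (n * a)
  have h3 := dependenceDefect_le hθ1 hl hl1 hln h (x := n * a) (hln'.trans hna)
  rw [min_eq_right hna, div_self hn0.ne', mul_one] at h3
  have h4 := h.wsumCdf_le_one subset_rfl (n * a)
  have h5 := log_le_shiftDefect hθ hl hl1 hln h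
  have h6 := shiftDefect_nonneg (P := P) (X := X) (n := n) hθ hl (n * a)
  -- At `x = n * a` the shift term is at most the defect, which is `O(n d)` for the distance `d`,
  -- plus the Riemann and dependence terms, which are `O(l)`.
  have h7 : θ * |β| * shiftDefect P X β l n (n * a) ≤ |sumDefect P X θ β l n (n * a)|
      + |sumDefect P X θ β l n (n * a) + θ * β * shiftDefect P X β l n (n * a)| := by
    have h8 := abs_sub (sumDefect P X θ β l n (n * a) + θ * β * shiftDefect P X β l n (n * a))
      (sumDefect P X θ β l n (n * a))
    rw [add_sub_cancel_left, abs_mul (θ * β), abs_mul θ, abs_of_pos hθ, abs_of_nonneg h6] at h8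
    linarith
  have h9 := mul_le_mul_of_nonneg_left h5 (mul_nonneg hθ.le hb)
  have h10 := mul_le_mul_of_nonneg_left h4 (mul_nonneg hθ.le hl0.le)
  have h11 := mul_le_mul_of_nonneg_left h3 hθ.le
  linarith

end

end DickmanKolmogorov

/-! ### Assembly of the upper and lower bounds -/

open DickmanKolmogorov in
theorem theorem1p1 (θ β : ℝ) (hθ : 0 < θ) :
    (∃ C : ℝ, 0 < C ∧ ∀ (l n : ℕ), 1 ≤ l → ∀ (hl : θ - β ≤ (l : ℝ)), l ≤ n →
      ∀ (Ω : Type u) [MeasurableSpace Ω] (P : Measure Ω) [IsProbabilityMeasure P]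
        (B : ℕ → Ω → ℝ), IsBernoulliFamily hθ hl n P B →
        (1 ≤ θ → kolmogorovDist (P.map (weightedSum B l n)) (dickman hθ) ≤
          C * (((l : ℝ) + |β| * Real.log ((n : ℝ) / (l : ℝ))) / (n : ℝ))) ∧
        (θ < 1 → kolmogorovDist (P.map (weightedSum B l n)) (dickman hθ) ≤
          C * (l : ℝ) ^ θ / (n : ℝ) ^ θ)) ∧
    (∀ (l : ℕ), 1 ≤ l → ∀ (hl : θ - β ≤ (l : ℝ)),
      ∃ C' : ℝ, 0 < C' ∧ ∀ (n : ℕ), l ≤ n →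
      ∀ (Ω : Type u) [MeasurableSpace Ω] (P : Measure Ω) [IsProbabilityMeasure P]
        (B : ℕ → Ω → ℝ), IsBernoulliFamily hθ hl n P B →
        (1 ≤ θ → C' * ((1 + |β| * Real.log (n : ℝ)) / (n : ℝ)) ≤
          kolmogorovDist (P.map (weightedSum B l n)) (dickman hθ)) ∧
        (θ < 1 → C' / (n : ℝ) ^ θ ≤
          kolmogorovDist (P.map (weightedSum B l n)) (dickman hθ))) := by
  have hb := abs_nonneg β
  have hT := one_le_tailConst β hθ
  have hD := dependenceConst_nonneg (β := β) hθ
  have hdick := isDickman_dickman hθ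
  have := hdick.isProbabilityMeasure
  obtain ⟨c, hc, hcdf⟩ := exists_cdf_dickman_eq hθ hdick
  rcases le_or_gt 1 θ with hθ1 | hθ1
  · refine ⟨⟨(3 + 2 * θ + 1 / θ) * defectConstGe θ β, ?_, ?_⟩, ?_⟩
    · unfold defectConstGe
      positivity
    · intro l n hl1 hl hln Ω _ P _ B hB
      have h := isBernoulliArray_of_family hB
      refine ⟨fun _ => ?_, fun hlt => absurd hlt (not_lt.2 hθ1)⟩
      rw [mul_assoc]
      exact kolmogorovDist_weightedSum_le hθ hl hl1 hln h
        fun x hx => abs_sumDefect_le_of_one_le hθ1 hl hl1 hln h hx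
    · intro l hl1 hl
      have hl1' : (1 : ℝ) ≤ l := by exact_mod_cast hl1
      -- The lattice bound will read `c₀ ≤ n d`: with `u ≥ 1 / 2` and `u - v = 1 / (2 n)`, the
      -- increment `c (u ^ θ - v ^ θ)` is at least `2 c₀ / n` and at most `2 d`.
      set c₀ := c * (1 / 2) ^ (θ - 1) / 4 with hc₀
      have hc₀pos : 0 < c₀ := by positivity
      set q := (2 + 2 * θ) * (2 * (θ + |β|) + 1) with hq
      set E := θ / 2 * (|β| * Real.log (l + |β|)) + θ * (1 + dependenceConst θ β) * l with hE
      have hE0 : 0 ≤ E := by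
        have : 0 ≤ Real.log (l + |β|) := Real.log_nonneg (by linarith)
        positivity
      have hq0 : 0 < q := by positivity
      -- The additive loss `E` in the logarithmic bound is absorbed through `E ≤ (E / c₀) n d`. The
      -- two summands of `r` then bound `1` and `|β| log n` by multiples of `n d`.
      set r := 1 / c₀ + (q + E / c₀) / (θ / 2) with hr
      have hr0 : 0 < r := by positivity
      refine ⟨1 / r, by positivity, ?_⟩
      intro n hln Ω _ P _ B hB
      have h : IsBernoulliArray P (Finset.Icc l n) (successProb θ β) B :=
        isBernoulliArray_of_family hB
      refine ⟨fun _ => ?_, fun hlt => absurd hlt (not_lt.2 hθ1)⟩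
      have hn : 1 ≤ n := hl1.trans hln
      have hn1 : (1 : ℝ) ≤ n := by exact_mod_cast hn
      have hn0 : (0 : ℝ) < n := by linarith
      have hlog := log_le_kolmogorovDist hθ1 hθ hl hl1 hln h
      -- The lattice interval just below `1` is used, because there `a ^ θ` has slope of order one;
      -- for `θ > 1` its slope vanishes at `0`.
      have hlat := cdf_dickman_sub_le (ν := dickman hθ) hn h (n - 1)
      set d := kolmogorovDist (P.map (weightedSum B l n)) (dickman hθ) with hd
      rw [Nat.cast_sub hn, Nat.cast_one] at hlat
      set u := ((n : ℝ) - 1 + 1 / 2) / n with hu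
      set v := ((n : ℝ) - 1) / n with hv
      have huv : u - v = 1 / (2 * n) := by rw [hu, hv]; field_simp; ring
      have hv0 : 0 ≤ v := div_nonneg (by linarith) hn0.le
      have hu1 : u ≤ 1 := (div_le_one hn0).2 (by linarith)
      have hu2 : 1 / 2 ≤ u := by rw [hu, div_le_div_iff₀ two_pos hn0]; linarith
      have hvu : v ≤ u := by
        have : 0 < 1 / (2 * (n : ℝ)) := by positivity
        linarith
      rw [hcdf u (hv0.trans hvu) hu1, hcdf v hv0 (hvu.trans hu1)] at hlat
      have hy : c₀ ≤ n * d := by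
        have h1 : u ^ θ = u ^ (θ - 1) * u := by
          rw [← Real.rpow_add_one (by linarith)]
          ring_nf
        have h2 : v ^ θ ≤ u ^ (θ - 1) * v := by
          rcases hv0.eq_or_lt with hv0 | hv0
          · rw [← hv0, Real.zero_rpow hθ.ne', mul_zero]
          · have : v ^ θ = v ^ (θ - 1) * v := by
              rw [← Real.rpow_add_one hv0.ne']
              ring_nf
            rw [this]
            gcongr
        have h3 : (1 / 2 : ℝ) ^ (θ - 1) ≤ u ^ (θ - 1) := by
          gcongr
        have h4 : c * ((1 / 2 : ℝ) ^ (θ - 1) * (1 / (2 * n))) ≤ 2 * d := by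
          calc c * ((1 / 2 : ℝ) ^ (θ - 1) * (1 / (2 * n)))
              ≤ c * (u ^ (θ - 1) * (u - v)) := by rw [huv]; gcongr
            _ ≤ c * (u ^ θ - v ^ θ) := by
                gcongr
                rw [h1]
                linarith
            _ ≤ 2 * d := by linarith
        have h5 : c₀ = n * (c * ((1 / 2 : ℝ) ^ (θ - 1) * (1 / (2 * n)))) / 2 := by
          rw [hc₀]
          field_simp
          ring
        rw [h5]
        have := mul_le_mul_of_nonneg_left h4 hn0.le
        linarith
      rw [mul_div_assoc', div_le_iff₀ hn0, one_div_mul_eq_div, div_le_iff₀ hr0]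
      have h1 : 1 ≤ 1 / c₀ * (n * d) := by
        rw [one_div_mul_eq_div]
        exact (one_le_div hc₀pos).2 hy
      have h2 : |β| * Real.log n ≤ (q + E / c₀) / (θ / 2) * (n * d) := by
        rw [div_mul_eq_mul_div, le_div_iff₀ (by positivity), mul_comm, add_mul]
        have h3 : E ≤ E / c₀ * (n * d) := by
          rw [div_mul_eq_mul_div, le_div_iff₀ hc₀pos]
          gcongr
        linarith
      rw [hr]
      linarith
  · refine ⟨⟨(3 + 2 * θ + 1 / θ) * defectConstLt θ β, ?_, ?_⟩, ?_⟩
    · have : 0 < 1 - θ := by linarith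
      unfold defectConstLt
      positivity
    · intro l n hl1 hl hln Ω _ P _ B hB
      have h := isBernoulliArray_of_family hB
      refine ⟨fun hge => absurd hge (not_le.2 hθ1), fun _ => ?_⟩
      rw [mul_div_assoc, ← Real.div_rpow l.cast_nonneg n.cast_nonneg, mul_assoc]
      exact kolmogorovDist_weightedSum_le hθ hl hl1 hln h
        fun x hx => abs_sumDefect_le_of_lt_one hθ hθ1 hl hl1 hln h hx
    · intro l hl1 hl
      refine ⟨c * (1 / 2) ^ θ / 2, by positivity, ?_⟩
      intro n hln Ω _ P _ B hB
      have h : IsBernoulliArray P (Finset.Icc l n) (successProb θ β) B :=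
        isBernoulliArray_of_family hB
      refine ⟨fun hge => absurd hge (not_le.2 hθ1), fun _ => ?_⟩
      have hn : 1 ≤ n := hl1.trans hln
      have hn1 : (1 : ℝ) ≤ n := by exact_mod_cast hn
      -- For `θ < 1` the steepest place is `0`: the Dickman law gives `[0, 1 / (2 n)]` mass `c (2 n)
      -- ^ (-θ)`.
      have hlat := cdf_dickman_sub_le (ν := dickman hθ) hn h 0
      rw [Nat.cast_zero, zero_add, zero_div, hcdf _ (by positivity)
        ((div_le_one (by linarith)).2 (by linarith)), hcdf 0 le_rfl zero_le_one,
        Real.zero_rpow hθ.ne', mul_zero, sub_zero,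
        Real.div_rpow (by norm_num) n.cast_nonneg] at hlat
      have e : c * (1 / 2) ^ θ / 2 / (n : ℝ) ^ θ = c * ((1 / 2) ^ θ / (n : ℝ) ^ θ) / 2 := by ring
      rw [e]
      linarith
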